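/- Let $a(0)=(a_1(0),a_2(0),\dots)$ be a real sequence and consider the system $$\dot a_n(t)=(n-1)a_{n-1}(t)-n\,a_{n+1}(t),\qquad n\ge 1,\ t\ge 0,\qquad a_0(t)=0, \tag{B}$$ with initial values $a_n(0)$. A *solution* means a solution of (B) on $[0,\infty)$ such that for every $T\geq 0$ the generating function $G(z,t)=\sum_{n\ge0}a_{n+1}(t)z^n$ converges in a neighbourhood of $z=0$ uniformly for $t\in[0,T]$, i.e. $|a_n(t)|\le K\gamma^n$ for all $n$ and all $t\in[0,T]$, with constants $K,\gamma$ depending on $T$. Let $A\in\mathbb R$, $A\ne0$, and $\alpha>0$. Consider the two conditions (C) $a_n(0)\sim -\frac{A}{\Gamma(\alpha)}(-1)^n n^{\alpha-1}$ as $n\to\infty$; (D) for some $\eta>0$ and $0<\theta<\pi/2$, $G_0(z)=\sum_{n\ge0}a_{n+1}(0)z^n$ converges near $0$ and extends to a function analytic (at every point) on $\Delta\setminus\{-1\}$, where $\Delta=\{z:|z|\le 1+\eta,\ |\arg(-(z+1))|\ge\theta\}$ with $\arg\in(-\pi,\pi]$, and $G_0(z)\sim A(1+z)^{-\alpha}$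 as $z\to-1$, $z\in\Delta\setminus\{-1\}$ (principal branch). Let $C^\alpha_n$ be the $n$-th Taylor coefficient at $z=0$ of $\frac1{1-z}\left(\frac{1-z}{1+z}\right)^\alpha$, and let $\mathcal E_{0,N}(t)=\sum_{n=0}^N|a_n(t)|^2$ (one-sided time derivative at $t=0$). 1. Assume (C) or (D). Then a solution exists, and every solution satisfies, for each fixed $n\ge1$, $$a_n(t)=e^{(2\alpha-1)t}\left(2^{1-\alpha}A\,C^\alpha_{n-1}+o(1)\right)\quad\text{as }t\to\infty;$$ in particular $a_n(t)\sim 2^{1-\alpha}e^{(2\alpha-1)t}A\,C^\alpha_{n-1}$ whenever $C^\alpha_{n-1}\neq0$. If $\alpha<1/2$, the system is conservative. (Conservative means: either $\sum_n|a_n(t)|^2$ is finite for every $t\geq 0$ and does not depend on $t$, or it is infinite for every $t\ge0$ and $\lim_{N\to\infty}\frac{d}{dt}\mathcal E_{0,N}(t)=0$ for every $t\ge0$.) 2. Assume (D). Then every solution satisfies, for every $t\ge0$, $$a_n(t)\sim\frac{A}{\Gamma(\alpha)}e^{(2\alpha-1)t}(-1)^{n-1}n^{\alpha-1}\quad\text{as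 }n\to\infty .$$ Moreover, for every $t\ge 0$: if $\alpha<1/2$, then $\frac{d}{dt}\mathcal E_{0,N}(t)\to0$ as $N\to\infty$; if $\alpha=1/2$, the energy $\sum_n|a_n(t)|^2$ is infinite and $\frac{d}{dt}\mathcal E_{0,N}(t)$ converges to a finite positive limit as $N\to\infty$ (finite explosion rate); if $\alpha>1/2$, the energy is infinite and $\frac{d}{dt}\mathcal E_{0,N}(t)\to+\infty$ as $N\to\infty$ (infinite explosion rate). -/

import Mathlib

open Filter Topology Asymptotics

namespace ShellModel

/-- `a` solves `ȧ_n = (n-1) a_{n-1} - n a_{n+1}` for `n ≥ 1` and all times `t ≥ 0`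
(one-sided derivative at `t = 0`), with boundary condition `a_0 = 0` and initial values
`a_n(0) = a₀ n` for `n ≥ 1`.  The last field says that the generating function
`G(z,t) = ∑ a_{n+1}(t) z^n` converges near `z = 0`, locally uniformly in time.
Without it the infinite system has nonzero solutions starting from zero. -/
structure IsSolution (a₀ : ℕ → ℝ) (a : ℕ → ℝ → ℝ) : Prop where
  boundary : ∀ t : ℝ, 0 ≤ t → a 0 t = 0
  initial : ∀ m : ℕ, a (m + 1) 0 = a₀ (m + 1)
  ode : ∀ (m : ℕ) (t : ℝ), 0 ≤ t →
    HasDerivWithinAt (a (m + 1)) ((m : ℝ) * a m t - ((m : ℝ) + 1) * a (m + 2) t) (Set.Ici 0) t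
  growth : ∀ T : ℝ, 0 ≤ T → ∃ K γ : ℝ, ∀ t : ℝ, 0 ≤ t → t ≤ T → ∀ n : ℕ, |a n t| ≤ K * γ ^ n

/-- The indented disk `{z : |z| ≤ |ζ| + η, |arg (z - ζ) - arg ζ| ≥ θ}`, the difference of
arguments being taken modulo `2π` in `(-π, π]`. -/
def deltaRegion (ζ : ℂ) (η θ : ℝ) : Set ℂ :=
  {z : ℂ | ‖z‖ ≤ ‖ζ‖ + η ∧ θ ≤ |Complex.arg ((z - ζ) / ζ)|}

/-- `G₀(z) = ∑ a₀(n+1) z^n` extends analytically to an indented disk at `-1` (punctured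
at `-1`), and `G₀(z) ∼ A (z+1)^{-α}` as `z → -1` in it. -/
def HasDeltaSingularity (a₀ : ℕ → ℝ) (A α : ℝ) : Prop :=
  ∃ (G₀ : ℂ → ℂ) (η θ : ℝ), 0 < η ∧ 0 < θ ∧ θ < Real.pi / 2 ∧
    (∀ᶠ z in 𝓝 (0 : ℂ), HasSum (fun n : ℕ => (a₀ (n + 1) : ℂ) * z ^ n) (G₀ z)) ∧
    AnalyticOnNhd ℂ G₀ (deltaRegion (-1) η θ \ {-1}) ∧
    G₀ ~[𝓝[deltaRegion (-1) η θ \ {-1}] (-1)] fun z : ℂ => (A : ℂ) * (z + 1) ^ (-(α : ℂ))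

/-- `a₀(n) ∼ C (-1)^n n^{α-1}` with the constant `C` written as `-A/Γ(α)`. -/
def HasAlternatingPowerLaw (a₀ : ℕ → ℝ) (A α : ℝ) : Prop :=
  a₀ ~[atTop] fun n : ℕ => -(A / Real.Gamma α) * (-1) ^ n * (n : ℝ) ^ (α - 1)

/-- The `n`-th Taylor coefficient at `0` of `(1-z)⁻¹ ((1-z)/(1+z))^α`. -/
noncomputable def taylorC (α : ℝ) (n : ℕ) : ℝ :=
  iteratedDeriv n (fun z : ℝ => 1 / (1 - z) * ((1 - z) / (1 + z)) ^ α) 0 / (n.factorial : ℝ)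

/-- The energy of the modes `M, …, N` at time `t`. -/
noncomputable def blockEnergy (a : ℕ → ℝ → ℝ) (M N : ℕ) (t : ℝ) : ℝ :=
  ∑ n ∈ Finset.Icc M N, |a n t| ^ 2

def FiniteEnergy (a : ℕ → ℝ → ℝ) (t : ℝ) : Prop :=
  Summable fun n : ℕ => |a n t| ^ 2

/-- The derivatives `d/dt E_{0,N}(t)` exist for all `N` and tend to the filter `l` as `N → ∞`. -/
def EnergyRateTendsto (a : ℕ → ℝ → ℝ) (t : ℝ) (l : Filter ℝ) : Prop :=
  ∃ D : ℕ → ℝ, (∀ N : ℕ, HasDerivWithinAt (blockEnergy a 0 N) (D N) (Set.Ici 0) t) ∧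
    Tendsto D atTop l

/-- Conservative: if the energy is finite, it does not change with time; if it is infinite,
`d/dt E_{0,N}(t) → 0` as `N → ∞` at every time. -/
def IsConservative (a : ℕ → ℝ → ℝ) : Prop :=
  (∀ t : ℝ, 0 ≤ t → FiniteEnergy a t ∧ ∑' n : ℕ, |a n t| ^ 2 = ∑' n : ℕ, |a n 0| ^ 2) ∨
  (∀ t : ℝ, 0 ≤ t → ¬ FiniteEnergy a t ∧ EnergyRateTendsto a t (𝓝 0))

/-- The energy is infinite and `d/dt E_{0,N}(t)` has a finite positive limit, at every time. -/
def HasFiniteExplosionRate (a : ℕ → ℝ → ℝ) : Prop :=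
  ∀ t : ℝ, 0 ≤ t → ¬ FiniteEnergy a t ∧ ∃ r : ℝ, 0 < r ∧ EnergyRateTendsto a t (𝓝 r)

/-- The energy is infinite and `d/dt E_{0,N}(t) → +∞`, at every time. -/
def HasInfiniteExplosionRate (a : ℕ → ℝ → ℝ) : Prop :=
  ∀ t : ℝ, 0 ≤ t → ¬ FiniteEnergy a t ∧ EnergyRateTendsto a t atTop

end ShellModel

namespace ShellModel

open Metric

/-! Write `G(z,t) = ∑ a_{n+1}(t) z^n`. The system becomes the transport equation `∂_t G = (z² - 1)
∂_z G + z G`. Its characteristics `w' = w² - 1` are automorphisms of the unit disk fixing `±1`, so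
`G(z,t) = G₀(flow t z) / flowDen t z` (`evolve`). The growth condition makes this the only solution
(`IsSolution.unique`), and every statement becomes one about an explicit function.

The exponent `2α - 1` comes from the fixed point `-1`. Since `1 + flow t z = e^{-t} (1 + z) /
flowDen t z` and `flowDen t (-1) = e^t`, the singular part `A (1 + w)^{-α}` is carried to `A e^{αt}
(flowDen t z)^{α-1} (1 + z)^{-α}`, which at `-1` has amplitude `A e^{(2α-1)t}`.

For `n → ∞` at fixed `t` under (D): Cauchy estimates in the indented disk show that the error `G₀ -
A (1 + z)^{-α}` has derivative `o(|1 + z|^{-α-1})`. This control (`IsLowerOrder`) survives the flow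
(`IsLowerOrder.evolve_sub`) and makes the error coefficients `o(n^{α-1})`
(`IsLowerOrder.taylorCoeff_isLittleO`); the binomial series supplies the main term. At `t = 0` this
shows that (D) implies (C).

For `t → ∞` at fixed `n`, (C) suffices: the flow drives the circle `|z| = 1/2` to `-1` with `1 -
|w|` at least of order `e^{-2t}`. The Abelian bound `IsGenerating.exists_bound_sub` then makes the
rescaled `G` converge boundedly on that circle to `A * limitShape α`, and Cauchy's formula gives the
coefficients (`IsGenerating.tendsto_shellSolution`).

Energy: the sum telescopes to `d/dt E_{0,N} = -2N a_N a_{N+1}`, which behaves like `2 L² N^{2α-1}`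
when `a_n ∼ L (-1)^{n+1} n^{α-1}`; this gives the trichotomy at `α = 1/2`. Conservation for `α <
1/2` under (C) alone cannot use asymptotics at later times. Instead, polynomial data give
exponentially decaying coefficients and conserve energy, and truncation extends this to all
finite-energy data considered here (`IsGenerating.energy_eq`). -/

/-! ### Taylor coefficients and Cauchy's formula. -/

/-- The `n`-th Taylor coefficient of `f` at the origin. -/
noncomputable def taylorCoeff (f : ℂ → ℂ) (n : ℕ) : ℂ :=
  iteratedDeriv n f 0 / (n.factorial : ℂ)

theorem iteratedDeriv_div_factorial_of_hasSum {𝕜 : Type*} [RCLike 𝕜] {f : 𝕜 → 𝕜} {c : ℕ → 𝕜}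
    (h : ∀ᶠ z in 𝓝 (0 : 𝕜), HasSum (fun n : ℕ => c n * z ^ n) (f z)) (n : ℕ) :
    iteratedDeriv n f 0 / (n.factorial : 𝕜) = c n := by
  have hp : HasFPowerSeriesAt f (FormalMultilinearSeries.ofScalars 𝕜 c) 0 := by
    rw [hasFPowerSeriesAt_iff]
    filter_upwards [h] with z hz
    simpa [FormalMultilinearSeries.coeff_ofScalars, mul_comm] using hz
  have h2 := hp.analyticAt.hasFPowerSeriesAt.eq_formalMultilinearSeries hp
  have h3 := congrArg (fun p : FormalMultilinearSeries 𝕜 𝕜 𝕜 => p.coeff n) h2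
  simpa [FormalMultilinearSeries.coeff_ofScalars] using h3

theorem taylorCoeff_eq_of_hasSum {f : ℂ → ℂ} {c : ℕ → ℂ}
    (h : ∀ᶠ z in 𝓝 (0 : ℂ), HasSum (fun n : ℕ => c n * z ^ n) (f z)) (n : ℕ) :
    taylorCoeff f n = c n :=
  iteratedDeriv_div_factorial_of_hasSum h n

theorem hasSum_taylorCoeff {f : ℂ → ℂ} {r : ℝ} (hf : DifferentiableOn ℂ f (ball 0 r)) {z : ℂ}
    (hz : z ∈ ball (0 : ℂ) r) : HasSum (fun n : ℕ => taylorCoeff f n * z ^ n) (f z) := by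
  have hr : 0 < r := (norm_nonneg z).trans_lt (by simpa using hz)
  lift r to NNReal using hr.le
  refine (Complex.hasSum_taylorSeries_on_ball hf hz).congr_fun fun n => ?_
  simp only [taylorCoeff, sub_zero, smul_eq_mul]
  ring

theorem taylorCoeff_congr {f g : ℂ → ℂ} (h : f =ᶠ[𝓝 0] g) (n : ℕ) :
    taylorCoeff f n = taylorCoeff g n := by
  rw [taylorCoeff, taylorCoeff, h.iteratedDeriv_eq]

theorem taylorCoeff_deriv (f : ℂ → ℂ) (n : ℕ) :
    taylorCoeff (deriv f) n = (n + 1) * taylorCoeff f (n + 1) := by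
  have h1 : (n.factorial : ℂ) ≠ 0 := by exact_mod_cast n.factorial_ne_zero
  have h2 : (n + 1 : ℂ) ≠ 0 := by exact_mod_cast n.succ_ne_zero
  rw [taylorCoeff, taylorCoeff, iteratedDeriv_succ', Nat.factorial_succ]
  push_cast
  field_simp

theorem taylorCoeff_eq_circleIntegral {f : ℂ → ℂ} {r R : ℝ} (hR : 0 < R) (hRr : R < r)
    (hf : DifferentiableOn ℂ f (ball 0 r)) (n : ℕ) :
    taylorCoeff f n =
      (2 * Real.pi * Complex.I)⁻¹ * ∮ z in C(0, R), (z ^ (n + 1))⁻¹ * f z := by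
  have h := ((hf.mono (closedBall_subset_ball hRr)).diffContOnCl_ball
    subset_rfl).circleIntegral_one_div_sub_center_pow_smul hR n
  have h1 : (n.factorial : ℂ) ≠ 0 := by exact_mod_cast n.factorial_ne_zero
  simp only [sub_zero, smul_eq_mul, one_div] at h
  rw [h, taylorCoeff]
  have := Complex.two_pi_I_ne_zero
  field_simp

theorem taylorCoeff_eq_intervalIntegral {f : ℂ → ℂ} {r R : ℝ} (hR : 0 < R) (hRr : R < r)
    (hf : DifferentiableOn ℂ f (ball 0 r)) (n : ℕ) :
    taylorCoeff f n =
      (2 * Real.pi : ℂ)⁻¹ * ∫ θ in (0 : ℝ)..2 * Real.pi,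
        ((circleMap 0 R θ) ^ n)⁻¹ * f (circleMap 0 R θ) := by
  rw [taylorCoeff_eq_circleIntegral hR hRr hf, circleIntegral]
  have : ∀ θ : ℝ, deriv (circleMap 0 R) θ • (((circleMap 0 R θ) ^ (n + 1))⁻¹ *
      f (circleMap 0 R θ)) =
      Complex.I * (((circleMap 0 R θ) ^ n)⁻¹ * f (circleMap 0 R θ)) := by
    intro θ
    have h0 : circleMap 0 R θ ≠ 0 := circleMap_ne_center hR.ne'
    rw [deriv_circleMap, smul_eq_mul, pow_succ]
    field_simp
  simp_rw [this]
  rw [intervalIntegral.integral_const_mul, mul_inv, mul_assoc, ← mul_assoc (Complex.I⁻¹),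
    inv_mul_cancel₀ Complex.I_ne_zero, one_mul]

theorem norm_taylorCoeff_le {f : ℂ → ℂ} {r R C : ℝ} (hR : 0 < R) (hRr : R < r)
    (hf : DifferentiableOn ℂ f (ball 0 r)) (hC : ∀ z ∈ sphere (0 : ℂ) R, ‖f z‖ ≤ C) (n : ℕ) :
    ‖taylorCoeff f n‖ ≤ C / R ^ n := by
  have h := Complex.norm_iteratedDeriv_le_of_forall_mem_sphere_norm_le n hR
    ((hf.mono (closedBall_subset_ball hRr)).diffContOnCl_ball subset_rfl) hC
  have h1 : (0 : ℝ) < n.factorial := by exact_mod_cast n.factorial_pos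
  rw [taylorCoeff, norm_div, Complex.norm_natCast, div_le_iff₀ h1]
  refine h.trans (le_of_eq ?_)
  ring

theorem taylorCoeff_sub {f g : ℂ → ℂ} {r : ℝ} (hr : 0 < r) (hf : DifferentiableOn ℂ f (ball 0 r))
    (hg : DifferentiableOn ℂ g (ball 0 r)) (n : ℕ) :
    taylorCoeff (fun z => f z - g z) n = taylorCoeff f n - taylorCoeff g n := by
  refine taylorCoeff_eq_of_hasSum (c := fun n => taylorCoeff f n - taylorCoeff g n) ?_ n
  filter_upwards [ball_mem_nhds (0 : ℂ) hr] with z hz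
  simpa [sub_mul] using (hasSum_taylorCoeff hf hz).sub (hasSum_taylorCoeff hg hz)

theorem taylorCoeff_const_mul {f : ℂ → ℂ} {r : ℝ} (hr : 0 < r)
    (hf : DifferentiableOn ℂ f (ball 0 r)) (c : ℂ) (n : ℕ) :
    taylorCoeff (fun z => c * f z) n = c * taylorCoeff f n := by
  refine taylorCoeff_eq_of_hasSum (c := fun n => c * taylorCoeff f n) ?_ n
  filter_upwards [ball_mem_nhds (0 : ℂ) hr] with z hz
  simpa [mul_assoc] using (hasSum_taylorCoeff hf hz).mul_left c

/-- Taylor coefficients converge under bounded pointwise convergence on a circle. -/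
theorem tendsto_taylorCoeff {ι : Type*} {l : Filter ι} [l.IsCountablyGenerated]
    {F : ι → ℂ → ℂ} {f : ℂ → ℂ} {r R C : ℝ} (hR : 0 < R) (hRr : R < r)
    (hF : ∀ i, DifferentiableOn ℂ (F i) (ball 0 r)) (hf : DifferentiableOn ℂ f (ball 0 r))
    (hC : ∀ᶠ i in l, ∀ z ∈ sphere (0 : ℂ) R, ‖F i z‖ ≤ C)
    (hlim : ∀ z ∈ sphere (0 : ℂ) R, Tendsto (fun i => F i z) l (𝓝 (f z))) (n : ℕ) :
    Tendsto (fun i => taylorCoeff (F i) n) l (𝓝 (taylorCoeff f n)) := by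
  have hmem : ∀ θ : ℝ, circleMap 0 R θ ∈ sphere (0 : ℂ) R := fun θ =>
    circleMap_mem_sphere 0 hR.le θ
  have hne : ∀ θ : ℝ, circleMap 0 R θ ≠ 0 := fun θ => circleMap_ne_center hR.ne'
  rw [taylorCoeff_eq_intervalIntegral hR hRr hf]
  simp_rw [fun i => taylorCoeff_eq_intervalIntegral hR hRr (hF i)]
  refine Tendsto.const_mul _ ?_
  refine intervalIntegral.tendsto_integral_filter_of_dominated_convergence
    (fun _ => (R ^ n)⁻¹ * C) ?_ ?_ (by simp) ?_
  · refine Eventually.of_forall fun i => Continuous.aestronglyMeasurable ?_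
    refine (((continuous_circleMap 0 R).pow n).inv₀ fun θ => pow_ne_zero _ (hne θ)).mul ?_
    exact (hF i).continuousOn.comp_continuous (continuous_circleMap 0 R) fun θ =>
      sphere_subset_closedBall.trans (closedBall_subset_ball hRr) (hmem θ)
  · filter_upwards [hC] with i hi
    refine Eventually.of_forall fun θ _ => ?_
    rw [norm_mul, norm_inv, norm_pow, norm_circleMap_zero, abs_of_pos hR]
    gcongr
    exact hi _ (hmem θ)
  · exact Eventually.of_forall fun θ _ => (hlim _ (hmem θ)).const_mul _

/-! ### The binomial series and the growth of its coefficients. -/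

/-- The coefficients of the binomial series `(1 - x)^{-α} = ∑ (α)_n / n! x^n`. -/
noncomputable def binomCoeff (α : ℝ) (n : ℕ) : ℝ :=
  (∏ j ∈ Finset.range n, (α + j)) / (n.factorial : ℝ)

theorem binomCoeff_pos {α : ℝ} (hα : 0 < α) (n : ℕ) : 0 < binomCoeff α n :=
  div_pos (Finset.prod_pos fun _ _ => by positivity) (by positivity)

theorem choose_eq_binomCoeff (α : ℝ) (n : ℕ) :
    Ring.choose (α + n - 1 : ℝ) n = binomCoeff α n := by
  have h := Ring.factorial_nsmul_multichoose_eq_ascPochhammer α n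
  rw [Ring.multichoose_eq, Polynomial.ascPochhammer_smeval_eq_eval,
    nsmul_eq_mul] at h
  have hp : ∀ m : ℕ, (ascPochhammer ℝ m).eval α = ∏ j ∈ Finset.range m, (α + j) := by
    intro m
    induction m with
    | zero => simp
    | succ m ih => rw [ascPochhammer_succ_eval, ih, Finset.prod_range_succ]
  rw [binomCoeff, ← hp, ← h]
  have : (n.factorial : ℝ) ≠ 0 := by exact_mod_cast n.factorial_ne_zero
  field_simp

theorem hasSum_binomCoeff (α : ℝ) {z : ℂ} (hz : ‖z‖ < 1) :
    HasSum (fun n : ℕ => (binomCoeff α n : ℂ) * z ^ n) ((1 - z) ^ (-(α : ℂ))) := by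
  have h := (Complex.one_div_one_sub_cpow_hasFPowerSeriesOnBall_zero (α : ℂ)).hasSum
    (y := z) (by
      rw [← ENNReal.ofReal_one, eball_ofReal]
      simpa using hz)
  rw [zero_add, one_div, ← Complex.cpow_neg] at h
  refine h.congr_fun fun n => ?_
  simp only [FormalMultilinearSeries.ofScalars_apply_eq, ← choose_eq_binomCoeff,
    Complex.ofReal_choose, smul_eq_mul]
  push_cast
  rfl

/-- The reciprocal of Euler's sequence `Real.GammaSeq α n` is this quotient times `(n + α) / n`, its
product having one factor more. -/
theorem tendsto_binomCoeff {α : ℝ} (hα : 0 < α) :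
    Tendsto (fun n : ℕ => binomCoeff α n / (n : ℝ) ^ (α - 1)) atTop (𝓝 (Real.Gamma α)⁻¹) := by
  have h := (Real.GammaSeq_tendsto_Gamma α).inv₀ (Real.Gamma_pos_of_pos hα).ne'
  have h2 : Tendsto (fun n : ℕ => (n : ℝ) / (n + α)) atTop (𝓝 1) := by
    exact tendsto_natCast_div_add_atTop α
  have h3 := h.mul h2
  rw [mul_one] at h3
  refine h3.congr' ?_
  filter_upwards [eventually_gt_atTop 0] with n hn
  have hn' : (0 : ℝ) < n := by exact_mod_cast hn
  have : (n.factorial : ℝ) ≠ 0 := by exact_mod_cast n.factorial_ne_zero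
  rw [Real.GammaSeq, binomCoeff, Finset.prod_range_succ, Real.rpow_sub_one hn'.ne']
  have h4 : (n : ℝ) ^ α ≠ 0 := (Real.rpow_pos_of_pos hn' _).ne'
  have h5 : α + n ≠ 0 := by positivity
  have h6 : (n : ℝ) + α ≠ 0 := by positivity
  field_simp
  ring

/-! ### The generator and time derivatives in terms of coefficients. -/

theorem taylorCoeff_id_mul {f : ℂ → ℂ} {r : ℝ} (hr : 0 < r)
    (hf : DifferentiableOn ℂ f (ball 0 r)) (n : ℕ) :
    taylorCoeff (fun z => z * f z) n = if n = 0 then 0 else taylorCoeff f (n - 1) := by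
  refine taylorCoeff_eq_of_hasSum (c := fun n => if n = 0 then 0 else taylorCoeff f (n - 1)) ?_ n
  filter_upwards [ball_mem_nhds (0 : ℂ) hr] with z hz
  have h := (hasSum_taylorCoeff hf hz).mul_left z
  rw [← hasSum_nat_add_iff' 1]
  simp only [Finset.range_one, Finset.sum_singleton, if_true, zero_mul, sub_zero,
    Nat.add_eq_zero_iff, one_ne_zero, and_false, if_false, Nat.add_sub_cancel]
  simpa [pow_succ', mul_left_comm] using h

/-- The Taylor coefficients of the generator of the flow of generating functions. -/
theorem taylorCoeff_generator {f : ℂ → ℂ} {r : ℝ} (hr : 0 < r)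
    (hf : DifferentiableOn ℂ f (ball 0 r)) (n : ℕ) :
    taylorCoeff (fun z => (z ^ 2 - 1) * deriv f z + z * f z) n =
      n * taylorCoeff f (n - 1) - (n + 1) * taylorCoeff f (n + 1) := by
  have hd : DifferentiableOn ℂ (deriv f) (ball 0 r) := hf.deriv isOpen_ball
  have h1 : DifferentiableOn ℂ (fun z => z * f z) (ball 0 r) := differentiableOn_id.mul hf
  have h2 : DifferentiableOn ℂ (deriv fun z => z * f z) (ball 0 r) := h1.deriv isOpen_ball
  -- The generator is `z (z f)' - f'`, whose two pieces act on coefficients as weighted shifts. At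
  -- `n = 0` the truncated index `n - 1` is harmless because its weight is `0`.
  have h3 : (fun z => (z ^ 2 - 1) * deriv f z + z * f z) =ᶠ[𝓝 0]
      fun z => z * deriv (fun z => z * f z) z - deriv f z := by
    filter_upwards [ball_mem_nhds (0 : ℂ) hr] with z hz
    have hz' : DifferentiableAt ℂ f z := hf.differentiableAt (isOpen_ball.mem_nhds hz)
    rw [((hasDerivAt_id' z).fun_mul hz'.hasDerivAt).deriv]
    ring
  rw [taylorCoeff_congr h3, taylorCoeff_sub hr (show DifferentiableOn ℂ
      (fun z => z * deriv (fun z => z * f z) z) (ball 0 r) from differentiableOn_id.mul h2) hd,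
    taylorCoeff_id_mul hr h2, taylorCoeff_deriv f]
  rcases n with _ | n
  · simp
  · rw [if_neg n.succ_ne_zero, Nat.add_sub_cancel, taylorCoeff_deriv, taylorCoeff_id_mul hr hf,
      if_neg n.succ_ne_zero, Nat.add_sub_cancel]
    push_cast
    ring

/-- Differentiation of Taylor coefficients with respect to a real parameter. -/
theorem hasDerivAt_taylorCoeff {F F' : ℝ → ℂ → ℂ} {r R : ℝ} (hR : 0 < R) (hRr : R < r)
    (hF : ∀ t, DifferentiableOn ℂ (F t) (ball 0 r))
    (hF' : ∀ t, DifferentiableOn ℂ (F' t) (ball 0 r))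
    (hd : ∀ t, ∀ z ∈ sphere (0 : ℂ) R, HasDerivAt (fun s => F s z) (F' t z) t)
    (hc : ContinuousOn (fun p : ℝ × ℂ => F' p.1 p.2) (Set.univ ×ˢ sphere 0 R)) (n : ℕ) (t : ℝ) :
    HasDerivAt (fun s => taylorCoeff (F s) n) (taylorCoeff (F' t) n) t := by
  have hmem : ∀ θ : ℝ, circleMap 0 R θ ∈ sphere (0 : ℂ) R := fun θ =>
    circleMap_mem_sphere 0 hR.le θ
  have hne : ∀ θ : ℝ, circleMap 0 R θ ≠ 0 := fun θ => circleMap_ne_center hR.ne'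
  have hcont : ∀ G : ℂ → ℂ, DifferentiableOn ℂ G (ball 0 r) →
      Continuous fun θ : ℝ => ((circleMap 0 R θ) ^ n)⁻¹ * G (circleMap 0 R θ) := by
    intro G hG
    refine (((continuous_circleMap 0 R).pow n).inv₀ fun θ => pow_ne_zero _ (hne θ)).mul ?_
    exact hG.continuousOn.comp_continuous (continuous_circleMap 0 R) fun θ =>
      sphere_subset_closedBall.trans (closedBall_subset_ball hRr) (hmem θ)
  have hK : IsCompact (Set.Icc (t - 1) (t + 1) ×ˢ sphere (0 : ℂ) R) :=
    isCompact_Icc.prod (isCompact_sphere 0 R)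
  -- Compactness of a time window times the circle yields the constant that dominates the
  -- differentiated integrand.
  obtain ⟨C, hC⟩ := hK.exists_bound_of_continuousOn
    (hc.mono (Set.prod_mono (Set.subset_univ _) subset_rfl))
  rw [taylorCoeff_eq_intervalIntegral hR hRr (hF' t)]
  rw [funext fun s => taylorCoeff_eq_intervalIntegral hR hRr (hF s) n]
  refine HasDerivAt.const_mul _ ?_
  refine (intervalIntegral.hasDerivAt_integral_of_dominated_loc_of_deriv_le
    (μ := MeasureTheory.volume)
    (F := fun s θ => ((circleMap 0 R θ) ^ n)⁻¹ * F s (circleMap 0 R θ))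
    (F' := fun s θ => ((circleMap 0 R θ) ^ n)⁻¹ * F' s (circleMap 0 R θ))
    (bound := fun _ => (R ^ n)⁻¹ * C) (Icc_mem_nhds (sub_one_lt t) (lt_add_one t))
    ?_ ?_ ?_ ?_ ?_ ?_).2
  · exact Eventually.of_forall fun s => (hcont _ (hF s)).aestronglyMeasurable
  · exact (hcont _ (hF t)).intervalIntegrable _ _
  · exact (hcont _ (hF' t)).aestronglyMeasurable
  · refine Eventually.of_forall fun θ _ s hs => ?_
    rw [norm_mul, norm_inv, norm_pow, norm_circleMap_zero, abs_of_pos hR]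
    gcongr
    exact hC (s, _) ⟨hs, hmem θ⟩
  · exact intervalIntegrable_const
  · exact Eventually.of_forall fun θ _ s _ => (hd s _ (hmem θ)).const_mul _

/-! ### The Möbius flow and the transported generating function. -/

/-- The denominator of the Möbius flow. -/
noncomputable def flowDen (t : ℝ) (z : ℂ) : ℂ := Real.cosh t - z * Real.sinh t

/-- The flow of the characteristics, a group of automorphisms of the unit disk. -/
noncomputable def flow (t : ℝ) (z : ℂ) : ℂ := (z * Real.cosh t - Real.sinh t) / flowDen t z

/-- The generating function at time `t` when it is `f` at time `0`. -/
noncomputable def evolve (f : ℂ → ℂ) (t : ℝ) (z : ℂ) : ℂ := f (flow t z) / flowDen t z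

theorem abs_sinh_lt_cosh (t : ℝ) : |Real.sinh t| < Real.cosh t := by
  rw [abs_lt]
  exact ⟨by have := Real.sinh_lt_cosh (-t); rw [Real.sinh_neg, Real.cosh_neg] at this; linarith,
    Real.sinh_lt_cosh t⟩

theorem flowDen_ne_zero_of_lt {t : ℝ} {z : ℂ} (hz : ‖z‖ * |Real.sinh t| < Real.cosh t) :
    flowDen t z ≠ 0 := by
  intro h
  have h1 : (Real.cosh t : ℂ) = z * Real.sinh t := sub_eq_zero.mp h
  have h2 := congrArg norm h1
  rw [norm_mul, Complex.norm_real, Complex.norm_real, Real.norm_eq_abs, Real.norm_eq_abs,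
    abs_of_pos (Real.cosh_pos t)] at h2
  linarith

theorem flowDen_ne_zero (t : ℝ) {z : ℂ} (hz : ‖z‖ ≤ 1) : flowDen t z ≠ 0 :=
  flowDen_ne_zero_of_lt ((mul_le_of_le_one_left (abs_nonneg _) hz).trans_lt (abs_sinh_lt_cosh t))

/-- Numerator and denominator of the flow arise from `(z, 1)` by a hyperbolic rotation, which
preserves `|v|² - |u|²`. This is why the flow maps the disk into itself. -/
theorem norm_sq_flowDen_sub (t : ℝ) (z : ℂ) :
    ‖flowDen t z‖ ^ 2 - ‖z * Real.cosh t - Real.sinh t‖ ^ 2 = 1 - ‖z‖ ^ 2 := by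
  rw [← Complex.normSq_eq_norm_sq, ← Complex.normSq_eq_norm_sq, ← Complex.normSq_eq_norm_sq,
    Complex.normSq_apply, Complex.normSq_apply, Complex.normSq_apply]
  simp only [flowDen, Complex.sub_re, Complex.sub_im, Complex.mul_re, Complex.mul_im,
    Complex.ofReal_re, Complex.ofReal_im]
  linear_combination (1 - z.re ^ 2 - z.im ^ 2) * Real.cosh_sq t

theorem one_sub_norm_flow_sq (t : ℝ) {z : ℂ} (hz : ‖z‖ ≤ 1) :
    1 - ‖flow t z‖ ^ 2 = (1 - ‖z‖ ^ 2) / ‖flowDen t z‖ ^ 2 := by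
  have h : ‖flowDen t z‖ ≠ 0 := norm_ne_zero_iff.mpr (flowDen_ne_zero t hz)
  rw [← norm_sq_flowDen_sub t z, flow, norm_div]
  field_simp

theorem norm_flow_lt_one (t : ℝ) {z : ℂ} (hz : ‖z‖ < 1) : ‖flow t z‖ < 1 := by
  have h : 0 < ‖flowDen t z‖ := norm_pos_iff.mpr (flowDen_ne_zero t hz.le)
  have h1 : 0 < 1 - ‖flow t z‖ ^ 2 := by
    rw [one_sub_norm_flow_sq t hz.le]
    exact div_pos (by nlinarith [norm_nonneg z]) (by positivity)
  nlinarith [norm_nonneg (flow t z)]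

/-- The point `-1` is fixed. The exact factor by which the distance to it changes is the source of
all exponents in `t`. -/
theorem one_add_flow (t : ℝ) {z : ℂ} (h : flowDen t z ≠ 0) :
    1 + flow t z = Real.exp (-t) * (1 + z) / flowDen t z := by
  rw [flow, ← Real.cosh_sub_sinh, Complex.ofReal_sub]
  field_simp
  rw [flowDen]
  ring

theorem flow_zero (z : ℂ) : flow 0 z = z := by simp [flow, flowDen]

theorem evolve_zero (f : ℂ → ℂ) : evolve f 0 = f := by
  funext z
  simp [evolve, flow_zero, flowDen]

theorem cosh_sq_sub_sinh_sq (t : ℝ) : (Real.cosh t : ℂ) ^ 2 - (Real.sinh t : ℂ) ^ 2 = 1 := by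
  exact_mod_cast Real.cosh_sq_sub_sinh_sq t

theorem hasDerivAt_flowDen_space (t : ℝ) (z : ℂ) :
    HasDerivAt (flowDen t) (-(Real.sinh t : ℂ)) z := by
  refine (((hasDerivAt_id' z).mul_const (Real.sinh t : ℂ)).const_sub
    (Real.cosh t : ℂ)).congr_deriv ?_
  rw [one_mul]

theorem hasDerivAt_flow_space {t : ℝ} {z : ℂ} (h : flowDen t z ≠ 0) :
    HasDerivAt (flow t) ((flowDen t z)⁻¹ ^ 2) z := by
  have h1 : HasDerivAt (fun w : ℂ => w * (Real.cosh t : ℂ) - Real.sinh t) (Real.cosh t : ℂ) z := by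
    simpa using ((hasDerivAt_id' z).mul_const (Real.cosh t : ℂ)).sub_const (Real.sinh t : ℂ)
  refine (h1.div (hasDerivAt_flowDen_space t z) h).congr_deriv ?_
  field_simp
  rw [flowDen]
  linear_combination cosh_sq_sub_sinh_sq t

theorem hasDerivAt_cosh_ofReal (t : ℝ) :
    HasDerivAt (fun s : ℝ => (Real.cosh s : ℂ)) (Real.sinh t : ℂ) t :=
  (Real.hasDerivAt_cosh t).ofReal_comp

theorem hasDerivAt_sinh_ofReal (t : ℝ) :
    HasDerivAt (fun s : ℝ => (Real.sinh s : ℂ)) (Real.cosh t : ℂ) t :=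
  (Real.hasDerivAt_sinh t).ofReal_comp

theorem hasDerivAt_flowDen_time (t : ℝ) (z : ℂ) :
    HasDerivAt (fun s => flowDen s z) (-(z * Real.cosh t - Real.sinh t)) t := by
  refine ((hasDerivAt_cosh_ofReal t).sub ((hasDerivAt_sinh_ofReal t).const_mul z)).congr_deriv ?_
  ring

theorem hasDerivAt_flow_time {t : ℝ} {z : ℂ} (h : flowDen t z ≠ 0) :
    HasDerivAt (fun s => flow s z) (flow t z ^ 2 - 1) t := by
  have h1 : HasDerivAt (fun s : ℝ => z * (Real.cosh s : ℂ) - Real.sinh s)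
      (-flowDen t z) t := by
    refine (((hasDerivAt_cosh_ofReal t).const_mul z).sub (hasDerivAt_sinh_ofReal t)).congr_deriv ?_
    rw [flowDen]
    ring
  refine (h1.div (hasDerivAt_flowDen_time t z) h).congr_deriv ?_
  rw [flow]
  field_simp
  ring

theorem hasDerivAt_evolve_space {f : ℂ → ℂ} {t : ℝ} {z : ℂ} (h : flowDen t z ≠ 0)
    (hf : DifferentiableAt ℂ f (flow t z)) :
    HasDerivAt (evolve f t) (deriv f (flow t z) * (flowDen t z)⁻¹ ^ 3 +
      f (flow t z) * (Real.sinh t * (flowDen t z)⁻¹ ^ 2)) z := by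
  refine ((hf.hasDerivAt.comp z (hasDerivAt_flow_space h)).div
    (hasDerivAt_flowDen_space t z) h).congr_deriv ?_
  simp only [Function.comp_apply]
  field_simp
  ring

/-- The transport equation for `G`. It works because the flow commutes with its own vector field,
`(z² - 1) ∂_z flow = flow² - 1`, and because the factor `1 / flowDen` produces the term `z G`. -/
theorem hasDerivAt_evolve_time {f : ℂ → ℂ} {t : ℝ} {z : ℂ} (h : flowDen t z ≠ 0)
    (hf : DifferentiableAt ℂ f (flow t z)) :
    HasDerivAt (fun s => evolve f s z)
      ((z ^ 2 - 1) * deriv (evolve f t) z + z * evolve f t z) t := by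
  have h1 := (hf.hasDerivAt.comp t (hasDerivAt_flow_time h)).div (hasDerivAt_flowDen_time t z) h
  refine h1.congr_deriv ?_
  rw [(hasDerivAt_evolve_space h hf).deriv, evolve]
  simp only [Function.comp_apply]
  have e1 : (z * Real.cosh t - Real.sinh t) = flow t z * flowDen t z := by
    rw [flow]; field_simp
  have e2 : (flow t z ^ 2 - 1) * flowDen t z ^ 2 = z ^ 2 - 1 := by
    rw [sub_mul, ← mul_pow, ← e1, flowDen]
    linear_combination (z ^ 2 - 1) * cosh_sq_sub_sinh_sq t
  have e3 : flow t z * flowDen t z = (z ^ 2 - 1) * Real.sinh t + z * flowDen t z := by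
    rw [← e1, flowDen]; ring
  rw [e1]
  field_simp
  rw [mul_sub, mul_neg, sub_neg_eq_add]
  linear_combination deriv f (flow t z) * e2 + flowDen t z * f (flow t z) * e3

theorem continuousOn_flowDen (s : Set (ℝ × ℂ)) :
    ContinuousOn (fun p : ℝ × ℂ => flowDen p.1 p.2) s := by
  refine Continuous.continuousOn ?_
  unfold flowDen
  fun_prop

theorem continuousOn_flow :
    ContinuousOn (fun p : ℝ × ℂ => flow p.1 p.2) (Set.univ ×ˢ ball 0 1) := by
  refine ContinuousOn.div (Continuous.continuousOn (by fun_prop)) (continuousOn_flowDen _) ?_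
  rintro ⟨t, z⟩ ⟨-, hz⟩
  exact flowDen_ne_zero t (by simpa using (mem_ball_zero_iff.mp hz).le)

theorem flow_mem_ball (t : ℝ) {z : ℂ} (hz : z ∈ ball (0 : ℂ) 1) : flow t z ∈ ball (0 : ℂ) 1 := by
  rw [mem_ball_zero_iff] at hz ⊢
  exact norm_flow_lt_one t hz

theorem continuousOn_evolve {f : ℂ → ℂ} (hf : ContinuousOn f (ball 0 1)) :
    ContinuousOn (fun p : ℝ × ℂ => evolve f p.1 p.2) (Set.univ ×ˢ ball 0 1) := by
  refine ContinuousOn.div ?_ (continuousOn_flowDen _) ?_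
  · exact hf.comp continuousOn_flow fun p hp => flow_mem_ball p.1 hp.2
  · rintro ⟨t, z⟩ ⟨-, hz⟩
    exact flowDen_ne_zero t (by simpa using (mem_ball_zero_iff.mp hz).le)

theorem differentiableOn_evolve {f : ℂ → ℂ} (hf : DifferentiableOn ℂ f (ball 0 1)) (t : ℝ) :
    DifferentiableOn ℂ (evolve f t) (ball 0 1) := fun _ hz =>
  (hasDerivAt_evolve_space (flowDen_ne_zero t (mem_ball_zero_iff.mp hz).le)
    (hf.differentiableAt (isOpen_ball.mem_nhds
      (flow_mem_ball t hz)))).differentiableAt.differentiableWithinAt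

theorem hasDerivAt_taylorCoeff_evolve {f : ℂ → ℂ} (hf : DifferentiableOn ℂ f (ball 0 1))
    (n : ℕ) (t : ℝ) :
    HasDerivAt (fun s => taylorCoeff (evolve f s) n)
      (n * taylorCoeff (evolve f t) (n - 1) - (n + 1) * taylorCoeff (evolve f t) (n + 1)) t := by
  have hev := differentiableOn_evolve hf
  rw [← taylorCoeff_generator one_pos (hev t)]
  have hsub : sphere (0 : ℂ) (1 / 2) ⊆ ball 0 1 :=
    sphere_subset_closedBall.trans (closedBall_subset_ball (by norm_num))
  refine hasDerivAt_taylorCoeff (F' := fun t z => (z ^ 2 - 1) * deriv (evolve f t) z +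
    z * evolve f t z) (R := 1 / 2) (by norm_num) (by norm_num) hev ?_ ?_ ?_ n t
  · intro t
    exact ((differentiableOn_id.pow 2).sub_const 1 |>.mul ((hev t).deriv isOpen_ball)).add
      (differentiableOn_id.mul (hev t))
  · intro t z hz
    exact hasDerivAt_evolve_time (flowDen_ne_zero t (mem_ball_zero_iff.mp (hsub hz)).le)
      (hf.differentiableAt (isOpen_ball.mem_nhds (flow_mem_ball t (hsub hz))))
  · refine ContinuousOn.mono ?_ (Set.prod_mono subset_rfl hsub)
    have hd : ContinuousOn (deriv f) (ball 0 1) := (hf.deriv isOpen_ball).continuousOn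
    have hmaps : Set.MapsTo (fun p : ℝ × ℂ => flow p.1 p.2) (Set.univ ×ˢ ball 0 1)
        (ball 0 1) := fun p hp => flow_mem_ball p.1 hp.2
    have hden : ContinuousOn (fun p : ℝ × ℂ => (flowDen p.1 p.2)⁻¹) (Set.univ ×ˢ ball 0 1) :=
      (continuousOn_flowDen _).inv₀ fun p hp => flowDen_ne_zero p.1 (mem_ball_zero_iff.mp hp.2).le
    have h1 : ContinuousOn (fun p : ℝ × ℂ => deriv f (flow p.1 p.2) * (flowDen p.1 p.2)⁻¹ ^ 3 +
        f (flow p.1 p.2) * (Real.sinh p.1 * (flowDen p.1 p.2)⁻¹ ^ 2)) (Set.univ ×ˢ ball 0 1) := by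
      refine ((hd.comp continuousOn_flow hmaps).mul (hden.pow 3)).add
        ((hf.continuousOn.comp continuousOn_flow hmaps).mul (ContinuousOn.mul ?_ (hden.pow 2)))
      exact Continuous.continuousOn (by fun_prop)
    have h2 : ContinuousOn (fun p : ℝ × ℂ => deriv (evolve f p.1) p.2)
        (Set.univ ×ˢ ball 0 1) := by
      refine h1.congr fun p hp => ?_
      exact (hasDerivAt_evolve_space (flowDen_ne_zero p.1 (mem_ball_zero_iff.mp hp.2).le)
        (hf.differentiableAt (isOpen_ball.mem_nhds (flow_mem_ball p.1 hp.2)))).deriv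
    exact (ContinuousOn.mul (Continuous.continuousOn (by fun_prop)) h2).add
      (ContinuousOn.mul (Continuous.continuousOn (by fun_prop))
        (continuousOn_evolve hf.continuousOn))

/-! ### The explicit solution. -/

/-- The solution of the system whose generating function at time `0` is `f`. -/
noncomputable def shellSolution (f : ℂ → ℂ) (n : ℕ) (t : ℝ) : ℝ :=
  if n = 0 then 0 else (taylorCoeff (evolve f t) (n - 1)).re

theorem shellSolution_zero (f : ℂ → ℂ) (t : ℝ) : shellSolution f 0 t = 0 := if_pos rfl

theorem shellSolution_succ (f : ℂ → ℂ) (n : ℕ) (t : ℝ) :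
    shellSolution f (n + 1) t = (taylorCoeff (evolve f t) n).re := by
  rw [shellSolution, if_neg n.succ_ne_zero, Nat.add_sub_cancel]

/-- The generating function of `a₀` represents `f` near the origin, and `f` is holomorphic in the
unit disk. -/
structure IsGenerating (a₀ : ℕ → ℝ) (f : ℂ → ℂ) : Prop where
  differentiableOn : DifferentiableOn ℂ f (ball 0 1)
  taylorCoeff_eq : ∀ n : ℕ, taylorCoeff f n = (a₀ (n + 1) : ℂ)

theorem hasDerivAt_shellSolution {f : ℂ → ℂ} (hf : DifferentiableOn ℂ f (ball 0 1))
    (m : ℕ) (t : ℝ) :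
    HasDerivAt (shellSolution f (m + 1))
      ((m : ℝ) * shellSolution f m t - ((m : ℝ) + 1) * shellSolution f (m + 2) t) t := by
  have h := Complex.reCLM.hasFDerivAt.comp_hasDerivAt t (hasDerivAt_taylorCoeff_evolve hf m t)
  have e : shellSolution f (m + 1) =
      (⇑Complex.reCLM ∘ fun s => taylorCoeff (evolve f s) m) := by
    funext s
    exact shellSolution_succ f m s
  rw [e]
  refine h.congr_deriv ?_
  rw [shellSolution_succ f (m + 1)]
  rcases m with _ | m
  · simp
  · rw [shellSolution_succ f m]
    simp

/-- The radius is left free: `R < 1` yields the growth condition for a general `f`, while `R > 1`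
yields exponential decay for polynomial data. -/
theorem exists_bound_taylorCoeff_evolve {f : ℂ → ℂ} {T R : ℝ} (hR : 0 < R)
    (hc : ContinuousOn (fun p : ℝ × ℂ => evolve f p.1 p.2) (Set.Icc 0 T ×ˢ closedBall 0 R))
    {r : ℝ} (hr : R < r) (hd : ∀ t ∈ Set.Icc 0 T, DifferentiableOn ℂ (evolve f t) (ball 0 r)) :
    ∃ K : ℝ, 0 ≤ K ∧ ∀ t ∈ Set.Icc 0 T, ∀ n : ℕ, |shellSolution f n t| ≤ K * (R⁻¹) ^ n := by
  have hK : IsCompact (Set.Icc 0 T ×ˢ closedBall (0 : ℂ) R) :=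
    isCompact_Icc.prod (isCompact_closedBall 0 R)
  obtain ⟨C, hC⟩ := hK.exists_bound_of_continuousOn hc
  refine ⟨|C| * R, by positivity, fun t ht n => ?_⟩
  rcases n with _ | n
  · rw [shellSolution_zero, abs_zero]; positivity
  · rw [shellSolution_succ]
    refine (Complex.abs_re_le_norm _).trans ((norm_taylorCoeff_le hR hr (hd t ht)
      (fun z hz => (hC (t, z) ⟨ht, sphere_subset_closedBall hz⟩).trans (le_abs_self C)) n).trans
        (le_of_eq ?_))
    rw [pow_succ, inv_pow]
    field_simp

theorem isSolution_shellSolution {a₀ : ℕ → ℝ} {f : ℂ → ℂ} (hf : IsGenerating a₀ f) :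
    IsSolution a₀ (shellSolution f) where
  boundary t _ := shellSolution_zero f t
  initial m := by rw [shellSolution_succ, evolve_zero, hf.taylorCoeff_eq, Complex.ofReal_re]
  ode m t _ := (hasDerivAt_shellSolution hf.differentiableOn m t).hasDerivWithinAt
  growth T _ := by
    obtain ⟨K, -, hK⟩ := exists_bound_taylorCoeff_evolve (f := f) (T := T) (R := 1 / 2) (r := 1)
      (by norm_num) ((continuousOn_evolve hf.differentiableOn.continuousOn).mono
        (Set.prod_mono (Set.subset_univ _) (closedBall_subset_ball (by norm_num))))
      (by norm_num) fun t _ => differentiableOn_evolve hf.differentiableOn t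
    exact ⟨K, _, fun t h0 hT n => hK t ⟨h0, hT⟩ n⟩

/-! ### Uniqueness under the growth condition. -/

/-- Iterated bounds for a solution of the system that vanishes at time `t₀`. -/
theorem abs_le_of_vanishing {d : ℕ → ℝ → ℝ} {K γ t₀ T : ℝ} (hK : 0 ≤ K) (hγ : 1 ≤ γ)
    (h0 : ∀ t ∈ Set.Icc t₀ T, d 0 t = 0) (hinit : ∀ n, d n t₀ = 0)
    (hode : ∀ (m : ℕ), ∀ t ∈ Set.Icc t₀ T, HasDerivWithinAt (d (m + 1))
      ((m : ℝ) * d m t - ((m : ℝ) + 1) * d (m + 2) t) (Set.Ici t₀) t)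
    (hb : ∀ t ∈ Set.Icc t₀ T, ∀ n, |d n t| ≤ K * γ ^ n) (k : ℕ) :
    ∀ t ∈ Set.Icc t₀ T, ∀ n : ℕ,
      |d n t| ≤ K * γ ^ (n + k) * (2 * (t - t₀)) ^ k * ((n + k).choose k : ℝ) := by
  induction k with
  | zero => intro t ht n; simpa using hb t ht n
  | succ k ih =>
    intro t ht n
    have hst : 0 ≤ t - t₀ := sub_nonneg.mpr ht.1
    rcases n with _ | m
    · rw [h0 t ht, abs_zero]; positivity
    -- The constant that makes `c (x - t₀)^{k+1}` an antiderivative of a bound for the right-hand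
    -- side of the equation; `hch` below is the binomial identity that matches the two.
    set c : ℝ := K * γ ^ (m + 2 + k) * 2 ^ (k + 1) * ((m + 2 + k).choose (k + 1) : ℝ) with hc
    have hB : ∀ x : ℝ, HasDerivAt (fun x => c * (x - t₀) ^ (k + 1))
        (c * ((k + 1) * (x - t₀) ^ k)) x := by
      intro x
      refine ((((hasDerivAt_id' x).sub_const t₀).fun_pow (k + 1)).const_mul c).congr_deriv ?_
      push_cast
      simp
    have key := image_norm_le_of_norm_deriv_right_le_deriv_boundary (f := d (m + 1))
      (f' := fun t => (m : ℝ) * d m t - ((m : ℝ) + 1) * d (m + 2) t) (a := t₀) (b := T)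
      (fun x hx => (hode m x hx).continuousWithinAt.mono Set.Icc_subset_Ici_self)
      (fun x hx => (hode m x ⟨hx.1, hx.2.le⟩).mono (Set.Ici_subset_Ici.mpr hx.1))
      (B := fun x => c * (x - t₀) ^ (k + 1)) (by simp [hinit]) hB ?_ ht
    · refine key.trans (le_of_eq ?_)
      rw [hc, mul_pow, show m + 1 + (k + 1) = m + 2 + k by ring]
      ring
    · intro x hx
      have hx' : x ∈ Set.Icc t₀ T := ⟨hx.1, hx.2.le⟩
      have hsx : 0 ≤ x - t₀ := sub_nonneg.mpr hx.1
      set b : ℝ := K * γ ^ (m + 2 + k) * (2 * (x - t₀)) ^ k * ((m + 2 + k).choose k : ℝ) with hbdef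
      have hb0 : 0 ≤ b := by positivity
      have h2 : |d (m + 2) x| ≤ b := ih x hx' (m + 2)
      -- The bound for mode `m` is enlarged to that for mode `m + 2`, using `1 ≤ γ` and the
      -- monotonicity of binomial coefficients.
      have h1 : |d m x| ≤ b := by
        refine (ih x hx' m).trans ?_
        rw [hbdef]
        have : (m + k).choose k ≤ (m + 2 + k).choose k := Nat.choose_le_choose k (by omega)
        gcongr
        · omega
      have hch : ((m + 2 + k).choose (k + 1) : ℝ) * (k + 1) = (m + 2 + k).choose k * (m + 2) := by
        have := Nat.choose_succ_right_eq (m + 2 + k) k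
        rw [Nat.add_sub_cancel] at this
        exact_mod_cast this
      calc ‖(m : ℝ) * d m x - ((m : ℝ) + 1) * d (m + 2) x‖
          ≤ ‖(m : ℝ) * d m x‖ + ‖((m : ℝ) + 1) * d (m + 2) x‖ := norm_sub_le _ _
        _ = m * |d m x| + (m + 1) * |d (m + 2) x| := by
            rw [norm_mul, norm_mul, Real.norm_eq_abs, Real.norm_eq_abs, Real.norm_eq_abs,
              Real.norm_eq_abs, Nat.abs_cast, abs_of_nonneg (by positivity : (0 : ℝ) ≤ m + 1)]
        _ ≤ m * b + (m + 1) * b := by gcongr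
        _ ≤ 2 * (m + 2) * b := by nlinarith
        _ = c * ((k + 1) * (x - t₀) ^ k) := by
            rw [hbdef, hc, mul_pow, pow_succ 2 k]
            linear_combination (-(2 * K * γ ^ (m + 2 + k) * 2 ^ k * (x - t₀) ^ k)) * hch

/-- With the binomial coefficient at most `2^{n+k}`, the iterated bound is geometric in `k` with
ratio `4γ(t - t₀) < 1`; letting `k → ∞` kills it. -/
theorem eq_zero_of_vanishing_short {d : ℕ → ℝ → ℝ} {K γ t₀ T : ℝ} (hK : 0 ≤ K) (hγ : 1 ≤ γ)
    (h0 : ∀ t ∈ Set.Icc t₀ T, d 0 t = 0) (hinit : ∀ n, d n t₀ = 0)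
    (hode : ∀ (m : ℕ), ∀ t ∈ Set.Icc t₀ T, HasDerivWithinAt (d (m + 1))
      ((m : ℝ) * d m t - ((m : ℝ) + 1) * d (m + 2) t) (Set.Ici t₀) t)
    (hb : ∀ t ∈ Set.Icc t₀ T, ∀ n, |d n t| ≤ K * γ ^ n) {t : ℝ} (ht : t ∈ Set.Icc t₀ T)
    (hshort : 4 * γ * (t - t₀) < 1) (n : ℕ) : d n t = 0 := by
  have hst : 0 ≤ t - t₀ := sub_nonneg.mpr ht.1
  have hle : ∀ k : ℕ, |d n t| ≤ K * γ ^ n * 2 ^ n * (4 * γ * (t - t₀)) ^ k := by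
    intro k
    refine (abs_le_of_vanishing hK hγ h0 hinit hode hb k t ht n).trans ?_
    have hch : ((n + k).choose k : ℝ) ≤ 2 ^ (n + k) := by
      exact_mod_cast Nat.choose_le_two_pow (n + k) k
    calc K * γ ^ (n + k) * (2 * (t - t₀)) ^ k * ((n + k).choose k : ℝ)
        ≤ K * γ ^ (n + k) * (2 * (t - t₀)) ^ k * 2 ^ (n + k) := by gcongr
      _ = _ := by
        rw [show (4 : ℝ) * γ * (t - t₀) = γ * (2 * (t - t₀)) * 2 by ring, mul_pow _ (2 : ℝ) k,
          mul_pow γ, pow_add, pow_add]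
        ring
  have hlim : Tendsto (fun k : ℕ => K * γ ^ n * 2 ^ n * (4 * γ * (t - t₀)) ^ k) atTop (𝓝 0) := by
    simpa using (tendsto_pow_atTop_nhds_zero_of_lt_one (by positivity) hshort).const_mul
      (K * γ ^ n * 2 ^ n)
  exact abs_nonpos_iff.mp (ge_of_tendsto' hlim hle)

theorem IsSolution.unique {a₀ : ℕ → ℝ} {a b : ℕ → ℝ → ℝ} (ha : IsSolution a₀ a)
    (hb : IsSolution a₀ b) (n : ℕ) {T : ℝ} (hT : 0 ≤ T) : a n T = b n T := by
  obtain ⟨K₁, γ₁, h₁⟩ := ha.growth T hT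
  obtain ⟨K₂, γ₂, h₂⟩ := hb.growth T hT
  set γ : ℝ := max 1 (max |γ₁| |γ₂|) with hγdef
  have hγ : 1 ≤ γ := le_max_left _ _
  set d : ℕ → ℝ → ℝ := fun n t => a n t - b n t with hd
  have hbd : ∀ t ∈ Set.Icc 0 T, ∀ n, |d n t| ≤ (|K₁| + |K₂|) * γ ^ n := by
    intro t ht n
    have e : ∀ K g : ℝ, |g| ≤ γ → K * g ^ n ≤ |K| * γ ^ n := by
      intro K g hg
      refine (le_abs_self _).trans ?_
      rw [abs_mul, abs_pow]
      gcongr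
    calc |d n t| ≤ |a n t| + |b n t| := abs_sub _ _
      _ ≤ |K₁| * γ ^ n + |K₂| * γ ^ n := add_le_add
        ((h₁ t ht.1 ht.2 n).trans (e _ _ ((le_max_left _ _).trans (le_max_right _ _))))
        ((h₂ t ht.1 ht.2 n).trans (e _ _ ((le_max_right _ _).trans (le_max_right _ _))))
      _ = _ := by ring
  have hode : ∀ (m : ℕ), ∀ t : ℝ, 0 ≤ t → HasDerivWithinAt (d (m + 1))
      ((m : ℝ) * d m t - ((m : ℝ) + 1) * d (m + 2) t) (Set.Ici 0) t := by
    intro m t ht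
    refine ((ha.ode m t ht).sub (hb.ode m t ht)).congr_deriv ?_
    rw [hd]
    ring
  have hd0 : ∀ t : ℝ, 0 ≤ t → d 0 t = 0 := fun t ht => by
    simp [hd, ha.boundary t ht, hb.boundary t ht]
  -- One exponential bound holds on all of `[0, T]`, so the short-time argument can be restarted
  -- with the same step `1/(8γ)`, half of what it allows.
  have hstep : ∀ j : ℕ, ∀ t ∈ Set.Icc 0 T, t ≤ j * (8 * γ)⁻¹ → ∀ n, d n t = 0 := by
    intro j
    induction j with
    | zero =>
      intro t ht htj n
      have : t = 0 := le_antisymm (by simpa using htj) ht.1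
      subst this
      rcases n with _ | n
      · exact hd0 0 le_rfl
      · simp [hd, ha.initial, hb.initial]
    | succ j ih =>
      intro t ht htj n
      rcases le_or_gt t (j * (8 * γ)⁻¹) with h | h
      · exact ih t ht h n
      have hj0 : 0 ≤ j * (8 * γ)⁻¹ := by positivity
      refine eq_zero_of_vanishing_short (d := d) (K := |K₁| + |K₂|) (γ := γ)
        (t₀ := j * (8 * γ)⁻¹) (T := T) (by positivity) hγ ?_ ?_ ?_ ?_ ⟨h.le, ht.2⟩ ?_ n
      · exact fun s hs => hd0 s (hj0.trans hs.1)
      · exact ih _ ⟨hj0, h.le.trans ht.2⟩ le_rfl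
      · exact fun m s hs => (hode m s (hj0.trans hs.1)).mono (Set.Ici_subset_Ici.mpr hj0)
      · exact fun s hs => hbd s ⟨hj0.trans hs.1, hs.2⟩
      · have h3 : t - j * (8 * γ)⁻¹ ≤ (8 * γ)⁻¹ := by push_cast at htj; linarith
        have h4 : γ * (8 * γ)⁻¹ = 1 / 8 := by field_simp
        nlinarith
  obtain ⟨j, hj⟩ := exists_nat_ge (T * (8 * γ))
  have := hstep j T ⟨hT, le_rfl⟩ (by
    rw [← div_eq_mul_inv, le_div_iff₀ (by positivity)]
    exact hj) n
  exact sub_eq_zero.mp this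

/-! ### Transfer of lower-order bounds to Taylor coefficients. -/

/-- `h` is holomorphic in the unit disk and of lower order than `(1 + z)^{-α}` at `-1`, in the
sense that is needed to transfer the estimate to the Taylor coefficients. -/
structure IsLowerOrder (α : ℝ) (h : ℂ → ℂ) : Prop where
  differentiableOn : DifferentiableOn ℂ h (ball 0 1)
  bound : ∃ C : ℝ, ∀ z ∈ ball (0 : ℂ) 1, ‖h z‖ ≤ C * ‖1 + z‖ ^ (-α)
  deriv_bound : ∀ ε : ℝ, 0 < ε → ∃ C : ℝ, ∀ z ∈ ball (0 : ℂ) 1,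
    ‖deriv h z‖ ≤ ε * ‖1 + z‖ ^ (-α - 1) + C

/-- From `|1 + r e^{iθ}|² = (1 - r)² + 2r(1 + cos θ)` and a quadratic lower bound for `1 + cos θ`;
the constant `5` only needs `π² ≤ 10`. -/
theorem le_norm_one_add_circleMap {r θ : ℝ} (hr : 1 / 2 ≤ r) (hr1 : r ≤ 1)
    (hθ : |θ - Real.pi| ≤ Real.pi) :
    (1 - r + |θ - Real.pi|) / 5 ≤ ‖1 + circleMap 0 r θ‖ := by
  have hcos := Real.cos_le_one_sub_mul_cos_sq hθ
  rw [Real.cos_sub_pi] at hcos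
  have hsq : ‖1 + circleMap 0 r θ‖ ^ 2 = (1 - r) ^ 2 + 2 * r * (1 + Real.cos θ) := by
    rw [← Complex.normSq_eq_norm_sq, Complex.normSq_apply, circleMap_zero]
    have e1 : (1 + (r : ℂ) * Complex.exp (θ * Complex.I)).re = 1 + r * Real.cos θ := by
      rw [Complex.exp_mul_I, ← Complex.ofReal_cos, ← Complex.ofReal_sin]
      simp only [Complex.add_re, Complex.add_im, Complex.one_re, Complex.mul_re,
        Complex.mul_im, Complex.ofReal_re, Complex.ofReal_im, Complex.I_re, Complex.I_im]
      ring
    have e2 : (1 + (r : ℂ) * Complex.exp (θ * Complex.I)).im = r * Real.sin θ := by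
      rw [Complex.exp_mul_I, ← Complex.ofReal_cos, ← Complex.ofReal_sin]
      simp only [Complex.add_re, Complex.add_im, Complex.one_im, Complex.mul_re,
        Complex.mul_im, Complex.ofReal_re, Complex.ofReal_im, Complex.I_re, Complex.I_im]
      ring
    rw [e1, e2]
    linear_combination r ^ 2 * Real.sin_sq_add_cos_sq θ
  have hpi : Real.pi ^ 2 ≤ 10 := by nlinarith [Real.pi_lt_d2, Real.pi_pos]
  have hv : |θ - Real.pi| ^ 2 = (θ - Real.pi) ^ 2 := sq_abs _
  have h2 : (1 / 5 : ℝ) ≤ 2 / Real.pi ^ 2 := by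
    rw [div_le_div_iff₀ (by norm_num) (by positivity)]
    linarith
  have h3 : 1 / 5 * (θ - Real.pi) ^ 2 ≤ 1 + Real.cos θ := by
    have := mul_le_mul_of_nonneg_right h2 (sq_nonneg (θ - Real.pi))
    linarith
  have h4 : 1 / 5 * (θ - Real.pi) ^ 2 ≤ 2 * r * (1 + Real.cos θ) := by
    nlinarith [sq_nonneg (θ - Real.pi)]
  refine (sq_le_sq₀ (by have := abs_nonneg (θ - Real.pi); linarith) (norm_nonneg _)).mp ?_
  rw [hsq]
  nlinarith [sq_nonneg (1 - r - |θ - Real.pi|), sq_nonneg (1 - r)]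

theorem integral_rpow_shift_le {α δ L : ℝ} (hα : 0 < α) (hδ : 0 < δ) (hL : 0 ≤ L) :
    ∫ x in δ..δ + L, x ^ (-α - 1) ≤ δ ^ (-α) / α := by
  have h0 : (0 : ℝ) ∉ Set.uIcc δ (δ + L) := by
    rw [Set.uIcc_of_le (by linarith)]
    exact fun h => absurd h.1 (not_le.mpr hδ)
  rw [integral_rpow (Or.inr ⟨by linarith, h0⟩), sub_add_cancel, div_neg, ← neg_div, neg_sub]
  have : 0 ≤ (δ + L) ^ (-α) := Real.rpow_nonneg (by linarith) _
  gcongr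
  linarith

theorem integral_norm_one_add_circleMap_le {α r : ℝ} (hα : 0 < α) (hr : 1 / 2 ≤ r) (hr1 : r < 1) :
    ∫ θ in (0 : ℝ)..2 * Real.pi, ‖1 + circleMap 0 r θ‖ ^ (-α - 1) ≤
      5 ^ (α + 1) * (2 / α) * (1 - r) ^ (-α) := by
  have hδ : 0 < 1 - r := by linarith
  have hpi := Real.pi_pos
  have hne : ∀ θ : ℝ, 1 + circleMap 0 r θ ≠ 0 := by
    intro θ h
    have h1 : circleMap 0 r θ = -1 := by linear_combination h
    have h2 := congrArg norm h1
    rw [norm_circleMap_zero, norm_neg, norm_one, abs_of_pos (by linarith)] at h2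
    linarith
  have hcont1 : Continuous fun θ : ℝ => ‖1 + circleMap 0 r θ‖ ^ (-α - 1) :=
    ((continuous_const.add (continuous_circleMap 0 r)).norm).rpow_const fun θ =>
      Or.inl (norm_ne_zero_iff.mpr (hne θ))
  have hpos : ∀ θ : ℝ, 0 < 1 - r + |θ - Real.pi| := fun θ => by positivity
  have hcont2 : Continuous fun θ : ℝ => 5 ^ (α + 1) * (1 - r + |θ - Real.pi|) ^ (-α - 1) :=
    continuous_const.mul ((continuous_const.add (continuous_id.sub continuous_const).abs).rpow_const
      fun θ => Or.inl (hpos θ).ne')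
  have hmono : ∀ θ ∈ Set.Icc 0 (2 * Real.pi), ‖1 + circleMap 0 r θ‖ ^ (-α - 1) ≤
      5 ^ (α + 1) * (1 - r + |θ - Real.pi|) ^ (-α - 1) := by
    intro θ hθ
    have h1 := le_norm_one_add_circleMap hr hr1.le (θ := θ) (by
      rw [abs_le]; constructor <;> linarith [hθ.1, hθ.2])
    refine (Real.rpow_le_rpow_of_nonpos (by have := hpos θ; positivity) h1
      (by linarith)).trans (le_of_eq ?_)
    rw [Real.div_rpow (hpos θ).le (by norm_num), show -α - 1 = -(α + 1) by ring,
      Real.rpow_neg (by norm_num : (0 : ℝ) ≤ 5), div_inv_eq_mul, mul_comm]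
  refine (intervalIntegral.integral_mono_on (by positivity) (hcont1.intervalIntegrable _ _)
    (hcont2.intervalIntegrable _ _) hmono).trans ?_
  rw [intervalIntegral.integral_const_mul, mul_assoc]
  refine mul_le_mul_of_nonneg_left ?_ (by positivity)
  have hcont3 : Continuous fun θ : ℝ => (1 - r + |θ - Real.pi|) ^ (-α - 1) :=
    (continuous_const.add (continuous_id.sub continuous_const).abs).rpow_const
      fun θ => Or.inl (hpos θ).ne'
  rw [← intervalIntegral.integral_add_adjacent_intervals (hcont3.intervalIntegrable 0 Real.pi)
    (hcont3.intervalIntegrable Real.pi (2 * Real.pi))]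
  have e1 : ∫ θ in (0 : ℝ)..Real.pi, (1 - r + |θ - Real.pi|) ^ (-α - 1) =
      ∫ x in (1 - r)..(1 - r) + Real.pi, x ^ (-α - 1) := by
    have h := intervalIntegral.integral_comp_sub_left (fun x : ℝ => x ^ (-α - 1))
      (1 - r + Real.pi) (a := 0) (b := Real.pi)
    rw [add_sub_cancel_right, sub_zero] at h
    rw [← h]
    refine intervalIntegral.integral_congr fun θ hθ => ?_
    rw [Set.uIcc_of_le hpi.le] at hθ
    rw [abs_of_nonpos (by linarith [hθ.2])]
    congr 1
    ring
  have e2 : ∫ θ in Real.pi..2 * Real.pi, (1 - r + |θ - Real.pi|) ^ (-α - 1) =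
      ∫ x in (1 - r)..(1 - r) + Real.pi, x ^ (-α - 1) := by
    have h := intervalIntegral.integral_comp_add_left (fun x : ℝ => x ^ (-α - 1))
      (1 - r - Real.pi) (a := Real.pi) (b := 2 * Real.pi)
    rw [show 1 - r - Real.pi + Real.pi = 1 - r by ring,
      show 1 - r - Real.pi + 2 * Real.pi = 1 - r + Real.pi by ring] at h
    rw [← h]
    refine intervalIntegral.integral_congr fun θ hθ => ?_
    rw [Set.uIcc_of_le (by linarith)] at hθ
    rw [abs_of_nonneg (by linarith [hθ.1])]
    congr 1
    ring
  rw [e1, e2]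
  have := integral_rpow_shift_le hα hδ hpi.le
  calc _ ≤ (1 - r) ^ (-α) / α + (1 - r) ^ (-α) / α := add_le_add this this
    _ = _ := by ring

/-- Cauchy's formula is applied to `h'` rather than `h`: the exponent `α + 1 > 1` concentrates the
integral near `-1` for every `α > 0`. On the circle of radius `1 - 1/N` it is `O(N^α)`, and the
factor `N` from differentiation is divided out. -/
theorem IsLowerOrder.taylorCoeff_isLittleO {α : ℝ} (hα : 0 < α) {h : ℂ → ℂ}
    (hh : IsLowerOrder α h) :
    (fun n : ℕ => taylorCoeff h n) =o[atTop] fun n : ℕ => (n : ℝ) ^ (α - 1) := by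
  rw [isLittleO_iff]
  intro c hc
  set M : ℝ := 5 ^ (α + 1) * (2 / α) with hM
  have hM0 : 0 < M := by positivity
  -- With `r^{-n} ≤ 3` below, this choice gives the singular part `c/2 · N^α`; the constant part
  -- takes the other half for large `N`, with `7` bounding `2π`.
  obtain ⟨C, hC⟩ := hh.deriv_bound (c / (6 * M)) (by positivity)
  have hlim : ∀ᶠ n : ℕ in atTop, 6 * |C| * 7 / c ≤ (n : ℝ) ^ α :=
    ((tendsto_rpow_atTop hα).comp tendsto_natCast_atTop_atTop).eventually_ge_atTop _
  filter_upwards [hlim, eventually_ge_atTop 2] with m hm hm2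
  obtain ⟨n, rfl⟩ : ∃ n, m = n + 1 := ⟨m - 1, by omega⟩
  have hn1 : 1 ≤ n := by omega
  have hn : (1 : ℝ) ≤ n := by exact_mod_cast hn1
  set N : ℝ := ((n + 1 : ℕ) : ℝ) with hN
  have hNn : N = n + 1 := by rw [hN]; push_cast; ring
  have hN0 : 0 < N := by rw [hNn]; positivity
  set r : ℝ := 1 - 1 / N with hr
  have hr_eq : r = n / N := by rw [hr, hNn]; field_simp; ring
  have hr2 : 1 / 2 ≤ r := by
    rw [hr_eq, hNn, div_le_div_iff₀ (by norm_num) (by positivity)]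
    linarith
  have hr1 : r < 1 := by rw [hr]; linarith [div_pos one_pos hN0]
  have hr0 : 0 < r := by linarith
  have hd : DifferentiableOn ℂ (deriv h) (ball 0 1) := hh.differentiableOn.deriv isOpen_ball
  have hmem : ∀ θ : ℝ, circleMap 0 r θ ∈ ball (0 : ℂ) 1 := fun θ => by
    rw [mem_ball_zero_iff, norm_circleMap_zero, abs_of_pos hr0]; exact hr1
  have hne : ∀ θ : ℝ, 1 + circleMap 0 r θ ≠ 0 := by
    intro θ h
    have h1 : circleMap 0 r θ = -1 := by linear_combination h
    have := hmem θ
    rw [h1] at this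
    simp at this
  have hcont1 : Continuous fun θ : ℝ => ‖1 + circleMap 0 r θ‖ ^ (-α - 1) :=
    ((continuous_const.add (continuous_circleMap 0 r)).norm).rpow_const fun θ =>
      Or.inl (norm_ne_zero_iff.mpr (hne θ))
  have hrn : (r ^ n)⁻¹ ≤ 3 := by
    have h1 : r⁻¹ = 1 + 1 / n := by rw [hr_eq, hNn]; field_simp
    rw [← inv_pow, h1]
    have h2 : (1 + 1 / (n : ℝ)) ≤ Real.exp (1 / n) := by
      have := Real.add_one_le_exp (1 / (n : ℝ)); linarith
    calc (1 + 1 / (n : ℝ)) ^ n ≤ Real.exp (1 / n) ^ n := by gcongr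
      _ = Real.exp 1 := by rw [← Real.exp_nat_mul]; congr 1; field_simp
      _ ≤ 3 := by linarith [Real.exp_one_lt_d9]
  have hint : ‖∫ θ in (0 : ℝ)..2 * Real.pi,
      ((circleMap 0 r θ) ^ n)⁻¹ * deriv h (circleMap 0 r θ)‖ ≤
      ∫ θ in (0 : ℝ)..2 * Real.pi,
        3 * (c / (6 * M) * ‖1 + circleMap 0 r θ‖ ^ (-α - 1) + |C|) := by
    refine intervalIntegral.norm_integral_le_of_norm_le (by positivity)
      (Eventually.of_forall fun θ _ => ?_) ?_
    · rw [norm_mul, norm_inv, norm_pow, norm_circleMap_zero, abs_of_pos hr0]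
      refine mul_le_mul hrn ((hC _ (hmem θ)).trans ?_) (norm_nonneg _) (by norm_num)
      gcongr
      exact le_abs_self C
    · exact (continuous_const.mul ((continuous_const.mul hcont1).add
        continuous_const)).intervalIntegrable _ _
  have hval : ∫ θ in (0 : ℝ)..2 * Real.pi,
      3 * (c / (6 * M) * ‖1 + circleMap 0 r θ‖ ^ (-α - 1) + |C|) ≤
      c / 2 * N ^ α + 3 * |C| * 7 := by
    rw [intervalIntegral.integral_const_mul, intervalIntegral.integral_add
      ((hcont1.const_mul _).intervalIntegrable _ _) intervalIntegrable_const,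
      intervalIntegral.integral_const_mul, intervalIntegral.integral_const]
    have h1 := integral_norm_one_add_circleMap_le hα hr2 hr1
    rw [← hM, show 1 - r = N⁻¹ by rw [hr]; ring, Real.inv_rpow hN0.le, ← Real.rpow_neg hN0.le,
      neg_neg] at h1
    have h2 : c / (6 * M) * ∫ θ in (0 : ℝ)..2 * Real.pi, ‖1 + circleMap 0 r θ‖ ^ (-α - 1) ≤
        c / 6 * N ^ α := by
      calc _ ≤ c / (6 * M) * (M * N ^ α) := by gcongr
        _ = _ := by field_simp
    have h3 : (2 * Real.pi - 0) • |C| ≤ 7 * |C| := by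
      rw [smul_eq_mul, sub_zero]
      have := Real.pi_lt_d2
      gcongr
      linarith
    linarith
  have hcoef : N * ‖taylorCoeff h (n + 1)‖ ≤ c * N ^ α := by
    have e := taylorCoeff_eq_intervalIntegral hr0 hr1 hd n
    rw [taylorCoeff_deriv] at e
    have e2 := congrArg norm e
    rw [norm_mul, norm_mul] at e2
    have e3 : ‖(n + 1 : ℂ)‖ = N := by
      rw [hN, ← Complex.norm_natCast]; push_cast; rfl
    have e4 : ‖(2 * Real.pi : ℂ)⁻¹‖ ≤ 1 := by
      rw [norm_inv]
      refine inv_le_one_of_one_le₀ ?_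
      rw [norm_mul, Complex.norm_real, Real.norm_eq_abs, abs_of_pos Real.pi_pos]
      norm_num
      linarith [Real.pi_gt_three]
    rw [e3] at e2
    rw [e2]
    have h7 : 6 * |C| * 7 ≤ c * N ^ α := by
      rw [div_le_iff₀ hc] at hm; linarith
    calc _ ≤ 1 * (c / 2 * N ^ α + 3 * |C| * 7) :=
          mul_le_mul e4 (hint.trans hval) (norm_nonneg _) one_pos.le
      _ ≤ _ := by linarith
  rw [Real.norm_eq_abs, abs_of_pos (Real.rpow_pos_of_pos hN0 _), Real.rpow_sub_one hN0.ne',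
    mul_div_assoc', le_div_iff₀ hN0]
  linarith

/-! ### Stability of the lower-order class, and propagation of the singularity. -/

theorem re_one_add_pos {z : ℂ} (hz : z ∈ ball (0 : ℂ) 1) : 0 < (1 + z).re := by
  have h := (abs_le.mp (Complex.abs_re_le_norm z)).1
  rw [mem_ball_zero_iff] at hz
  rw [Complex.add_re, Complex.one_re]
  linarith

theorem norm_one_add_pos {z : ℂ} (hz : z ∈ ball (0 : ℂ) 1) : 0 < ‖1 + z‖ :=
  norm_pos_iff.mpr fun h => by simpa [h] using re_one_add_pos hz

theorem norm_one_add_le_two {z : ℂ} (hz : z ∈ ball (0 : ℂ) 1) : ‖1 + z‖ ≤ 2 := by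
  rw [mem_ball_zero_iff] at hz
  have := norm_add_le (1 : ℂ) z
  rw [norm_one] at this
  linarith

theorem mem_slitPlane_of_re_pos {w : ℂ} (h : 0 < w.re) : w ∈ Complex.slitPlane :=
  Complex.mem_slitPlane_iff.mpr (Or.inl h)

theorem norm_cpow_neg_ofReal (w : ℂ) (α : ℝ) : ‖w ^ (-(α : ℂ))‖ = ‖w‖ ^ (-α) := by
  rw [← Complex.ofReal_neg, Complex.norm_cpow_real]

theorem hasDerivAt_one_add_cpow (α : ℝ) {z : ℂ} (h : 1 + z ∈ Complex.slitPlane) :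
    HasDerivAt (fun z : ℂ => (1 + z) ^ (-(α : ℂ))) (-(α : ℂ) * (1 + z) ^ (-(α : ℂ) - 1)) z := by
  simpa using ((hasDerivAt_id' z).const_add 1).cpow_const (c := -(α : ℂ)) h

theorem norm_cpow_neg_ofReal_sub_one (w : ℂ) (α : ℝ) :
    ‖w ^ (-(α : ℂ) - 1)‖ = ‖w‖ ^ (-α - 1) := by
  rw [← Complex.norm_cpow_real]
  push_cast
  rfl

/-- `x^{-α}` is of lower order than `x^{-α-1}`. -/
theorem exists_const_mul_rpow_le {α : ℝ} (hα : 0 < α) (C : ℝ) {ε : ℝ} (hε : 0 < ε) :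
    ∃ C' : ℝ, ∀ x : ℝ, 0 < x → C * x ^ (-α) ≤ ε * x ^ (-α - 1) + C' := by
  set δ : ℝ := ε / (|C| + 1) with hδ
  have hδ0 : 0 < δ := by positivity
  refine ⟨|C| * δ ^ (-α), fun x hx => ?_⟩
  have h1 : C * x ^ (-α) ≤ |C| * x ^ (-α) := by gcongr; exact le_abs_self C
  refine h1.trans ?_
  rcases le_or_gt x δ with h | h
  · have h2 : x ^ (-α) = x * x ^ (-α - 1) := by
      rw [Real.rpow_sub_one hx.ne']; field_simp
    have h3 : |C| * x ≤ ε := by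
      calc |C| * x ≤ (|C| + 1) * δ := by gcongr; linarith
        _ = ε := by rw [hδ]; field_simp
    have h4 : 0 ≤ x ^ (-α - 1) := by positivity
    calc |C| * x ^ (-α) = |C| * x * x ^ (-α - 1) := by rw [h2]; ring
      _ ≤ ε * x ^ (-α - 1) := by gcongr
      _ ≤ _ := le_add_of_nonneg_right (by positivity)
  · have h2 : x ^ (-α) ≤ δ ^ (-α) :=
      Real.rpow_le_rpow_of_nonpos hδ0 h.le (by linarith)
    have h4 : 0 ≤ ε * x ^ (-α - 1) := by positivity
    calc |C| * x ^ (-α) ≤ |C| * δ ^ (-α) := by gcongr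
      _ ≤ _ := le_add_of_nonneg_left h4

theorem IsLowerOrder.exists_nonneg_bound {α : ℝ} {h : ℂ → ℂ} (hh : IsLowerOrder α h) :
    ∃ C : ℝ, 0 ≤ C ∧ ∀ z ∈ ball (0 : ℂ) 1, ‖h z‖ ≤ C * ‖1 + z‖ ^ (-α) := by
  obtain ⟨C, hC⟩ := hh.bound
  refine ⟨|C|, abs_nonneg C, fun z hz => (hC z hz).trans ?_⟩
  gcongr
  exact le_abs_self C

theorem IsLowerOrder.add {α : ℝ} {g h : ℂ → ℂ} (hg : IsLowerOrder α g) (hh : IsLowerOrder α h) :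
    IsLowerOrder α fun z => g z + h z where
  differentiableOn := hg.differentiableOn.add hh.differentiableOn
  bound := by
    obtain ⟨C, hC⟩ := hg.bound
    obtain ⟨D, hD⟩ := hh.bound
    refine ⟨C + D, fun z hz => (norm_add_le _ _).trans ?_⟩
    rw [add_mul]
    exact add_le_add (hC z hz) (hD z hz)
  deriv_bound ε hε := by
    obtain ⟨C, hC⟩ := hg.deriv_bound (ε / 2) (by positivity)
    obtain ⟨D, hD⟩ := hh.deriv_bound (ε / 2) (by positivity)
    refine ⟨C + D, fun z hz => ?_⟩
    have hz' := isOpen_ball.mem_nhds hz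
    rw [deriv_fun_add (hg.differentiableOn.differentiableAt hz')
      (hh.differentiableOn.differentiableAt hz')]
    refine (norm_add_le _ _).trans ((add_le_add (hC z hz) (hD z hz)).trans (le_of_eq ?_))
    ring

/-- Bounds for a function that is holomorphic near the closed unit disk. -/
theorem exists_bound_of_differentiableOn_nhds {χ : ℂ → ℂ} {U : Set ℂ} (hU : IsOpen U)
    (hsub : closedBall (0 : ℂ) 1 ⊆ U) (hχ : DifferentiableOn ℂ χ U) :
    ∃ C : ℝ, 0 ≤ C ∧ ∀ z ∈ ball (0 : ℂ) 1, ‖χ z‖ ≤ C ∧ ‖deriv χ z‖ ≤ C ∧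
      ‖χ z - χ (-1)‖ ≤ C * ‖1 + z‖ := by
  obtain ⟨C₁, h₁⟩ := (isCompact_closedBall (0 : ℂ) 1).exists_bound_of_continuousOn
    (hχ.continuousOn.mono hsub)
  obtain ⟨C₂, h₂⟩ := (isCompact_closedBall (0 : ℂ) 1).exists_bound_of_continuousOn
    ((hχ.deriv hU).continuousOn.mono hsub)
  refine ⟨max |C₁| |C₂|, le_max_of_le_left (abs_nonneg _), fun z hz => ?_⟩
  have hz' := ball_subset_closedBall hz
  refine ⟨(h₁ z hz').trans ((le_abs_self _).trans (le_max_left _ _)),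
    (h₂ z hz').trans ((le_abs_self _).trans (le_max_right _ _)), ?_⟩
  have := (convex_closedBall (0 : ℂ) 1).norm_image_sub_le_of_norm_deriv_le (f := χ)
    (x := -1) (y := z) (C := max |C₁| |C₂|)
    (fun x hx => hχ.differentiableAt (hU.mem_nhds (hsub hx)))
    (fun x hx => (h₂ x hx).trans ((le_abs_self _).trans (le_max_right _ _))) (by simp) hz'
  rwa [sub_neg_eq_add, add_comm z 1] at this

/-- In `χ' h + χ h'` the first term is only `O(|1 + z|^{-α})`, which is absorbed in `ε |1 +
z|^{-α-1} + C`. -/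
theorem IsLowerOrder.mul_regular {α : ℝ} (hα : 0 < α) {h χ : ℂ → ℂ} (hh : IsLowerOrder α h)
    {U : Set ℂ} (hU : IsOpen U) (hsub : closedBall (0 : ℂ) 1 ⊆ U) (hχ : DifferentiableOn ℂ χ U) :
    IsLowerOrder α fun z => χ z * h z := by
  obtain ⟨B, hB0, hB⟩ := exists_bound_of_differentiableOn_nhds hU hsub hχ
  obtain ⟨C, hC0, hC⟩ := hh.exists_nonneg_bound
  have hχ' := hχ.mono (ball_subset_closedBall.trans hsub)
  refine ⟨hχ'.mul hh.differentiableOn, ⟨B * C, fun z hz => ?_⟩, fun ε hε => ?_⟩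
  · rw [norm_mul, mul_assoc]
    exact mul_le_mul (hB z hz).1 (hC z hz) (norm_nonneg _) hB0
  · obtain ⟨D, hD⟩ := hh.deriv_bound (ε / (2 * (B + 1))) (by positivity)
    obtain ⟨E, hE⟩ := exists_const_mul_rpow_le hα (B * C) (half_pos hε)
    refine ⟨B * |D| + E, fun z hz => ?_⟩
    have hz' := isOpen_ball.mem_nhds hz
    rw [deriv_fun_mul (hχ'.differentiableAt hz') (hh.differentiableOn.differentiableAt hz')]
    refine (norm_add_le _ _).trans ?_
    rw [norm_mul, norm_mul]
    have e1 : ‖deriv χ z‖ * ‖h z‖ ≤ B * C * ‖1 + z‖ ^ (-α) := by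
      rw [mul_assoc]
      exact mul_le_mul (hB z hz).2.1 (hC z hz) (norm_nonneg _) hB0
    have e2 := hE _ (norm_one_add_pos hz)
    have hX : 0 ≤ ‖1 + z‖ ^ (-α - 1) := by positivity
    have e3 : ‖χ z‖ * ‖deriv h z‖ ≤ ε / 2 * ‖1 + z‖ ^ (-α - 1) + B * |D| := by
      calc ‖χ z‖ * ‖deriv h z‖ ≤ B * (ε / (2 * (B + 1)) * ‖1 + z‖ ^ (-α - 1) + |D|) :=
            mul_le_mul (hB z hz).1 ((hD z hz).trans (by gcongr; exact le_abs_self D))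
              (norm_nonneg _) hB0
        _ = B / (B + 1) * (ε / 2 * ‖1 + z‖ ^ (-α - 1)) + B * |D| := by field_simp
        _ ≤ 1 * (ε / 2 * ‖1 + z‖ ^ (-α - 1)) + B * |D| := by
            gcongr
            rw [div_le_one (by positivity)]
            linarith
        _ = _ := by ring
    linarith

/-- The first factor vanishes at `-1` and gains a power of `|1 + z|`: only the value of a regular
amplitude at `-1` matters to leading order. -/
theorem isLowerOrder_regular_sub_mul {α : ℝ} (hα : 0 < α) {χ : ℂ → ℂ}
    {U : Set ℂ} (hU : IsOpen U) (hsub : closedBall (0 : ℂ) 1 ⊆ U) (hχ : DifferentiableOn ℂ χ U) :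
    IsLowerOrder α fun z => (χ z - χ (-1)) * (1 + z) ^ (-(α : ℂ)) := by
  obtain ⟨B, hB0, hB⟩ := exists_bound_of_differentiableOn_nhds hU hsub hχ
  have hχ' := hχ.mono (ball_subset_closedBall.trans hsub)
  have hder : ∀ z ∈ ball (0 : ℂ) 1, HasDerivAt (fun z => (χ z - χ (-1)) * (1 + z) ^ (-(α : ℂ)))
      (deriv χ z * (1 + z) ^ (-(α : ℂ)) +
        (χ z - χ (-1)) * (-(α : ℂ) * (1 + z) ^ (-(α : ℂ) - 1))) z := fun z hz =>
    ((hχ'.differentiableAt (isOpen_ball.mem_nhds hz)).hasDerivAt.sub_const _).mul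
      (hasDerivAt_one_add_cpow α (mem_slitPlane_of_re_pos (re_one_add_pos hz)))
  refine ⟨fun z hz => (hder z hz).differentiableAt.differentiableWithinAt,
    ⟨2 * B, fun z hz => ?_⟩, fun ε hε => ?_⟩
  · rw [norm_mul, norm_cpow_neg_ofReal]
    gcongr
    refine (hB z hz).2.2.trans ?_
    rw [mul_comm]
    gcongr
    exact norm_one_add_le_two hz
  · obtain ⟨E, hE⟩ := exists_const_mul_rpow_le hα (B + B * α) hε
    refine ⟨E, fun z hz => ?_⟩
    have hpos := norm_one_add_pos hz
    rw [(hder z hz).deriv]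
    refine ((norm_add_le _ _).trans ?_).trans (hE _ hpos)
    rw [norm_mul, norm_mul, norm_mul, norm_cpow_neg_ofReal, norm_cpow_neg_ofReal_sub_one, norm_neg,
      Complex.norm_real, Real.norm_eq_abs, abs_of_pos hα, add_mul]
    refine add_le_add (mul_le_mul_of_nonneg_right (hB z hz).2.1 (by positivity)) ?_
    calc _ ≤ B * ‖1 + z‖ * (α * ‖1 + z‖ ^ (-α - 1)) := by
          gcongr
          exact (hB z hz).2.2
      _ = _ := by rw [Real.rpow_sub_one hpos.ne']; field_simp

theorem re_flowDen_pos (t : ℝ) {z : ℂ} (hz : ‖z‖ ≤ 1) : 0 < (flowDen t z).re := by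
  have h1 : (flowDen t z).re = Real.cosh t - z.re * Real.sinh t := by
    simp only [flowDen, Complex.sub_re, Complex.mul_re, Complex.ofReal_re, Complex.ofReal_im]
    ring
  have h2 : z.re * Real.sinh t ≤ |Real.sinh t| := by
    refine (le_abs_self _).trans ?_
    rw [abs_mul]
    exact mul_le_of_le_one_left (abs_nonneg _) ((Complex.abs_re_le_norm z).trans hz)
  have := abs_sinh_lt_cosh t
  linarith

theorem differentiable_flowDen (t : ℝ) : Differentiable ℂ (flowDen t) := fun z =>
  (hasDerivAt_flowDen_space t z).differentiableAt

/-- A neighbourhood of the closed unit disk on which the denominator of the flow is in the right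
half plane. -/
def flowDomain (t : ℝ) : Set ℂ := {z : ℂ | 0 < (flowDen t z).re}

theorem isOpen_flowDomain (t : ℝ) : IsOpen (flowDomain t) :=
  isOpen_lt continuous_const (Complex.continuous_re.comp (differentiable_flowDen t).continuous)

theorem closedBall_subset_flowDomain (t : ℝ) : closedBall (0 : ℂ) 1 ⊆ flowDomain t :=
  fun _ hz => re_flowDen_pos t (mem_closedBall_zero_iff.mp hz)

theorem flowDen_ne_zero_of_mem_flowDomain {t : ℝ} {z : ℂ} (hz : z ∈ flowDomain t) :
    flowDen t z ≠ 0 := fun h => by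
  have : 0 < (flowDen t z).re := hz
  simp [h] at this

theorem differentiableOn_inv_flowDen (t : ℝ) :
    DifferentiableOn ℂ (fun z => (flowDen t z)⁻¹) (flowDomain t) := fun z hz =>
  ((differentiable_flowDen t z).inv (flowDen_ne_zero_of_mem_flowDomain hz)).differentiableWithinAt

theorem IsLowerOrder.comp_flow {α : ℝ} (hα : 0 < α) {h : ℂ → ℂ} (hh : IsLowerOrder α h) (t : ℝ) :
    IsLowerOrder α fun z => h (flow t z) := by
  obtain ⟨M, hM0, hM⟩ := exists_bound_of_differentiableOn_nhds isOpen_univ (Set.subset_univ _)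
    (differentiable_flowDen t).differentiableOn
  obtain ⟨M', hM'0, hM'⟩ := exists_bound_of_differentiableOn_nhds (isOpen_flowDomain t)
    (closedBall_subset_flowDomain t) (differentiableOn_inv_flowDen t)
  -- With `M` a bound for the denominator on the disk, `one_add_flow` shows that the flow shrinks
  -- `|1 + z|` at most by the factor `c`. Negative powers are therefore comparable.
  set c : ℝ := Real.exp (-t) / (M + 1) with hc
  have hc0 : 0 < c := by positivity
  have hle : ∀ z ∈ ball (0 : ℂ) 1, c * ‖1 + z‖ ≤ ‖1 + flow t z‖ := by
    intro z hz
    have hne := flowDen_ne_zero t (mem_ball_zero_iff.mp hz).le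
    have hd : 0 < ‖flowDen t z‖ := norm_pos_iff.mpr hne
    rw [one_add_flow t hne, norm_div, norm_mul, Complex.norm_real, Real.norm_eq_abs,
      abs_of_pos (Real.exp_pos _), hc, div_mul_eq_mul_div]
    gcongr
    linarith [(hM z hz).1]
  have hpow : ∀ s : ℝ, s ≤ 0 → ∀ z ∈ ball (0 : ℂ) 1,
      ‖1 + flow t z‖ ^ s ≤ c ^ s * ‖1 + z‖ ^ s := by
    intro s hs z hz
    rw [← Real.mul_rpow hc0.le (norm_nonneg _)]
    exact Real.rpow_le_rpow_of_nonpos (mul_pos hc0 (norm_one_add_pos hz)) (hle z hz) hs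
  have hder : ∀ z ∈ ball (0 : ℂ) 1, HasDerivAt (fun z => h (flow t z))
      (deriv h (flow t z) * (flowDen t z)⁻¹ ^ 2) z := fun z hz =>
    (hh.differentiableOn.differentiableAt
      (isOpen_ball.mem_nhds (flow_mem_ball t hz))).hasDerivAt.comp z
      (hasDerivAt_flow_space (flowDen_ne_zero t (mem_ball_zero_iff.mp hz).le))
  obtain ⟨C, hC0, hC⟩ := hh.exists_nonneg_bound
  refine ⟨fun z hz => (hder z hz).differentiableAt.differentiableWithinAt,
    ⟨C * c ^ (-α), fun z hz => ?_⟩, fun ε hε => ?_⟩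
  · refine (hC _ (flow_mem_ball t hz)).trans ?_
    rw [mul_assoc]
    gcongr
    exact hpow _ (by linarith) z hz
  · have hcp : 0 < c ^ (-α - 1) := by positivity
    obtain ⟨D, hD⟩ := hh.deriv_bound (ε / (c ^ (-α - 1) * (M' ^ 2 + 1))) (by positivity)
    refine ⟨|D| * M' ^ 2, fun z hz => ?_⟩
    rw [(hder z hz).deriv, norm_mul, norm_pow]
    have hX : 0 ≤ ‖1 + z‖ ^ (-α - 1) := by positivity
    calc ‖deriv h (flow t z)‖ * ‖(flowDen t z)⁻¹‖ ^ 2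
        ≤ (ε / (c ^ (-α - 1) * (M' ^ 2 + 1)) * (c ^ (-α - 1) * ‖1 + z‖ ^ (-α - 1)) + |D|) *
          M' ^ 2 := by
          gcongr
          · refine (hD _ (flow_mem_ball t hz)).trans ?_
            gcongr
            · exact hpow _ (by linarith) z hz
            · exact le_abs_self D
          · exact (hM' z hz).1
      _ = M' ^ 2 / (M' ^ 2 + 1) * (ε * ‖1 + z‖ ^ (-α - 1)) + |D| * M' ^ 2 := by
          field_simp
      _ ≤ 1 * (ε * ‖1 + z‖ ^ (-α - 1)) + |D| * M' ^ 2 := by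
          gcongr
          rw [div_le_one (by positivity)]
          linarith
      _ = _ := by ring

/-- Both arguments lie in `(-π/2, π/2)`, so their difference stays within the principal branch. -/
theorem log_div_of_re_pos {a b : ℂ} (ha : 0 < a.re) (hb : 0 < b.re) :
    Complex.log (a / b) = Complex.log a - Complex.log b := by
  have ha' := abs_lt.mp (Complex.abs_arg_lt_pi_div_two_iff.mpr (Or.inl ha))
  have hb' := abs_lt.mp (Complex.abs_arg_lt_pi_div_two_iff.mpr (Or.inl hb))
  have hpi := Real.pi_pos
  have ha0 : a ≠ 0 := fun h => by simp [h] at ha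
  have hb0 : b ≠ 0 := fun h => by simp [h] at hb
  have hne : b.arg ≠ Real.pi := by intro h; linarith [hb'.2]
  have harg : b⁻¹.arg = -b.arg := by rw [Complex.arg_inv, if_neg hne]
  rw [div_eq_mul_inv, Complex.log_mul ha0 (inv_ne_zero hb0), Complex.log_inv _ hne, sub_eq_add_neg]
  rw [harg]
  constructor <;> linarith [ha'.1, ha'.2, hb'.1, hb'.2]

/-- The principal power splits without a branch correction because `1 + z` and `flowDen t z` both
have positive real part. -/
theorem one_add_flow_cpow (α t : ℝ) {z : ℂ} (hz : z ∈ ball (0 : ℂ) 1) :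
    (1 + flow t z) ^ (-(α : ℂ)) =
      Real.exp (α * t) * (1 + z) ^ (-(α : ℂ)) * flowDen t z ^ (α : ℂ) := by
  have hz1 := (mem_ball_zero_iff.mp hz).le
  have h1 := re_one_add_pos hz
  have h2 := re_flowDen_pos t hz1
  have h1' : 1 + z ≠ 0 := fun h => by simp [h] at h1
  have h2' := flowDen_ne_zero t hz1
  have h3 : 1 + flow t z ≠ 0 := by
    rw [one_add_flow t h2']
    exact div_ne_zero (mul_ne_zero (by exact_mod_cast (Real.exp_pos _).ne') h1') h2'
  rw [Complex.cpow_def_of_ne_zero h3, Complex.cpow_def_of_ne_zero h1',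
    Complex.cpow_def_of_ne_zero h2', Complex.ofReal_exp, ← Complex.exp_add, ← Complex.exp_add,
    one_add_flow t h2', mul_div_assoc, Complex.log_ofReal_mul (Real.exp_pos _)
      (div_ne_zero h1' h2'), Real.log_exp, log_div_of_re_pos h1 h2]
  congr 1
  push_cast
  ring

theorem flowDen_cpow_div (α t : ℝ) {z : ℂ} (hz : flowDen t z ≠ 0) :
    flowDen t z ^ (α : ℂ) / flowDen t z = flowDen t z ^ ((α : ℂ) - 1) := by
  rw [Complex.cpow_sub _ _ hz, Complex.cpow_one]

theorem differentiableOn_flowDen_cpow (s : ℂ) (t : ℝ) :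
    DifferentiableOn ℂ (fun z => flowDen t z ^ s) (flowDomain t) := fun z hz =>
  ((hasDerivAt_flowDen_space t z).cpow_const (c := s)
    (mem_slitPlane_of_re_pos hz)).differentiableAt.differentiableWithinAt

theorem flowDen_neg_one (t : ℝ) : flowDen t (-1) = (Real.exp t : ℝ) := by
  rw [← Real.cosh_add_sinh, flowDen, Complex.ofReal_add]
  ring

theorem flowDen_neg_one_cpow (α t : ℝ) :
    flowDen t (-1) ^ ((α : ℂ) - 1) = Real.exp ((α - 1) * t) := by
  have : ((α : ℂ) - 1) = ((α - 1 : ℝ) : ℂ) := by push_cast; rfl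
  rw [flowDen_neg_one, this, ← Complex.ofReal_cpow (Real.exp_pos t).le, ← Real.exp_mul]
  rw [mul_comm]

/-- The flow propagates the singularity at `-1`. -/
theorem IsLowerOrder.evolve_sub {α : ℝ} (hα : 0 < α) {A : ℝ} {f : ℂ → ℂ}
    (hf : IsLowerOrder α fun z => f z - A * (1 + z) ^ (-(α : ℂ))) (t : ℝ) :
    IsLowerOrder α fun z => evolve f t z -
      (A * Real.exp ((2 * α - 1) * t) : ℝ) * (1 + z) ^ (-(α : ℂ)) := by
  have h1 := (hf.comp_flow hα t).mul_regular hα (isOpen_flowDomain t)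
    (closedBall_subset_flowDomain t) (differentiableOn_inv_flowDen t)
  have h2 := isLowerOrder_regular_sub_mul hα (isOpen_flowDomain t)
    (closedBall_subset_flowDomain t)
    ((differentiableOn_flowDen_cpow ((α : ℂ) - 1) t).const_mul ((A * Real.exp (α * t) : ℝ) : ℂ))
  -- The transported error, plus the amplitude `A e^{αt} flowDen^{α-1}` minus its value at `-1`.
  -- That value, `A e^{αt} e^{(α-1)t}`, is the new coefficient.
  have key : ∀ z ∈ ball (0 : ℂ) 1, evolve f t z -
      (A * Real.exp ((2 * α - 1) * t) : ℝ) * (1 + z) ^ (-(α : ℂ)) =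
      (flowDen t z)⁻¹ * (f (flow t z) - A * (1 + flow t z) ^ (-(α : ℂ))) +
      (((A * Real.exp (α * t) : ℝ) : ℂ) * flowDen t z ^ ((α : ℂ) - 1) -
        ((A * Real.exp (α * t) : ℝ) : ℂ) * flowDen t (-1) ^ ((α : ℂ) - 1)) *
        (1 + z) ^ (-(α : ℂ)) := by
    intro z hz
    have hne := flowDen_ne_zero t (mem_ball_zero_iff.mp hz).le
    have hexp : Real.exp ((2 * α - 1) * t) = Real.exp (α * t) * Real.exp ((α - 1) * t) := by
      rw [← Real.exp_add]; congr 1; ring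
    rw [one_add_flow_cpow α t hz, flowDen_neg_one_cpow, ← flowDen_cpow_div α t hne, evolve, hexp]
    push_cast
    field_simp
    ring
  have h3 := h1.add h2
  have hderiv : ∀ z ∈ ball (0 : ℂ) 1, deriv (fun z => evolve f t z -
      (A * Real.exp ((2 * α - 1) * t) : ℝ) * (1 + z) ^ (-(α : ℂ))) z = deriv _ z := fun z hz =>
    (Filter.eventuallyEq_of_mem (isOpen_ball.mem_nhds hz) key).deriv_eq
  refine ⟨h3.differentiableOn.congr key, ?_, fun ε hε => ?_⟩
  · obtain ⟨C, hC⟩ := h3.bound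
    exact ⟨C, fun z hz => by rw [key z hz]; exact hC z hz⟩
  · obtain ⟨C, hC⟩ := h3.deriv_bound ε hε
    exact ⟨C, fun z hz => by rw [hderiv z hz]; exact hC z hz⟩

/-- Transfer of the singularity at `-1` to the Taylor coefficients. -/
theorem IsLowerOrder.tendsto_taylorCoeff {α : ℝ} (hα : 0 < α) {B : ℝ} {f : ℂ → ℂ}
    (hf : IsLowerOrder α fun z => f z - B * (1 + z) ^ (-(α : ℂ))) :
    Tendsto (fun n : ℕ => (taylorCoeff f n).re * (-1) ^ n / (n : ℝ) ^ (α - 1)) atTop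
      (𝓝 (B / Real.Gamma α)) := by
  -- The main term is the binomial series at `-z`, hence the signs `(-1)^n`; the rest is covered by
  -- the transfer estimate.
  have hcoeff : ∀ n : ℕ, taylorCoeff f n = taylorCoeff (fun z => f z - B * (1 + z) ^ (-(α : ℂ))) n +
      B * (binomCoeff α n * (-1) ^ n) := by
    intro n
    refine taylorCoeff_eq_of_hasSum (c := fun n => taylorCoeff (fun z => f z -
      B * (1 + z) ^ (-(α : ℂ))) n + B * (binomCoeff α n * (-1) ^ n)) ?_ n
    filter_upwards [ball_mem_nhds (0 : ℂ) one_pos] with z hz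
    have h1 := hasSum_taylorCoeff hf.differentiableOn hz
    have h2 := (hasSum_binomCoeff α (z := -z) (by simpa using hz)).mul_left (B : ℂ)
    rw [sub_neg_eq_add] at h2
    have h3 := h1.add h2
    rw [sub_add_cancel] at h3
    refine h3.congr_fun fun n => ?_
    rw [neg_pow z]
    ring
  have h1 : Tendsto (fun n : ℕ => (taylorCoeff (fun z => f z - B * (1 + z) ^ (-(α : ℂ))) n).re *
      (-1) ^ n / (n : ℝ) ^ (α - 1)) atTop (𝓝 0) := by
    have h := (hf.taylorCoeff_isLittleO hα).norm_left.tendsto_div_nhds_zero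
    refine squeeze_zero_norm (fun n => ?_) h
    rw [norm_div, norm_mul, norm_pow, norm_neg, norm_one, one_pow, mul_one,
      Real.norm_of_nonneg (by positivity : (0 : ℝ) ≤ (n : ℝ) ^ (α - 1))]
    gcongr
    exact Complex.abs_re_le_norm _
  have h2 := (tendsto_binomCoeff hα).const_mul B
  have h3 := h1.add h2
  rw [zero_add, ← div_eq_mul_inv] at h3
  refine h3.congr fun n => ?_
  have hre : (B * (binomCoeff α n * (-1) ^ n) : ℂ).re = B * (binomCoeff α n * (-1) ^ n) := by
    rw [← Complex.ofReal_re (B * (binomCoeff α n * (-1) ^ n))]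
    push_cast
    rfl
  have hs : ((-1 : ℝ) ^ n) * (-1) ^ n = 1 := by rw [← mul_pow]; simp
  rw [hcoeff, Complex.add_re, hre]
  linear_combination (-(B * binomCoeff α n / (n : ℝ) ^ (α - 1))) * hs

/-! ### From the indented disk to the lower-order class. -/

/-- Taking cosines replaces the condition on the argument by a linear inequality in the real part
and the modulus. -/
theorem mem_deltaRegion_of_re {η θ : ℝ} (hθ : 0 < θ) (hθ' : θ < Real.pi / 2) {z : ℂ}
    (hne : 1 + z ≠ 0) (hnorm : ‖z‖ ≤ 1 + η) (hre : -(1 + z).re ≤ Real.cos θ * ‖1 + z‖) :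
    z ∈ deltaRegion (-1) η θ \ {-1} := by
  refine ⟨⟨by rwa [norm_neg, norm_one], ?_⟩, fun h => hne ?_⟩
  · have e : (z - -1) / -1 = -(1 + z) := by ring
    rw [e]
    by_contra! hlt
    have h1 := Real.strictAntiOn_cos ⟨abs_nonneg _, by linarith [Real.pi_pos]⟩
      ⟨hθ.le, by linarith [Real.pi_pos]⟩ hlt
    rw [Real.cos_abs, Complex.cos_arg (neg_ne_zero.mpr hne), norm_neg, Complex.neg_re,
      lt_div_iff₀ (norm_pos_iff.mpr hne)] at h1
    linarith
  · rw [Set.mem_singleton_iff.mp h]; ring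

theorem closedBall_subset_deltaRegion {η θ : ℝ} (hη : 0 < η) (hθ : 0 < θ)
    (hθ' : θ < Real.pi / 2) {z : ℂ} (hz : z ∈ closedBall (0 : ℂ) 1) (hne : 1 + z ≠ 0) :
    z ∈ deltaRegion (-1) η θ \ {-1} := by
  have hz1 := mem_closedBall_zero_iff.mp hz
  refine mem_deltaRegion_of_re hθ hθ' hne (by linarith) ?_
  have h1 := (abs_le.mp ((Complex.abs_re_le_norm z).trans hz1)).1
  have h2 : 0 ≤ Real.cos θ * ‖1 + z‖ :=
    mul_nonneg (Real.cos_nonneg_of_mem_Icc ⟨by linarith, hθ'.le⟩) (norm_nonneg _)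
  rw [Complex.add_re, Complex.one_re]
  linarith

/-- Room for Cauchy's estimate: a disk about `z` of radius proportional to `|1 + z|` may leave the
unit disk, yet stays in the indented disk and off the branch cut. On the cut one would have `-Re(1 +
w) = |1 + w|`, against `cos θ < 1`. -/
theorem near_of_mem_closedBall {η θ : ℝ} (hθ : 0 < θ) (hθ' : θ < Real.pi / 2) {z w : ℂ}
    (hz : z ∈ ball (0 : ℂ) 1) (hzη : ‖1 + z‖ ≤ η)
    (hw : w ∈ closedBall z (Real.cos θ / 2 * ‖1 + z‖)) :
    w ∈ deltaRegion (-1) η θ \ {-1} ∧ 1 + w ∈ Complex.slitPlane ∧ ‖1 + z‖ / 2 ≤ ‖1 + w‖ ∧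
      ‖1 + w‖ ≤ 2 * ‖1 + z‖ := by
  have hpos := norm_one_add_pos hz
  have hκ0 : 0 < Real.cos θ := Real.cos_pos_of_mem_Ioo ⟨by linarith, hθ'⟩
  have hκ1 : Real.cos θ < 1 := by
    have := Real.strictAntiOn_cos ⟨le_rfl, Real.pi_pos.le⟩ ⟨hθ.le, by linarith [Real.pi_pos]⟩ hθ
    rwa [Real.cos_zero] at this
  have hd : ‖w - z‖ ≤ Real.cos θ / 2 * ‖1 + z‖ := by rwa [← dist_eq_norm]
  have hsmall : Real.cos θ / 2 * ‖1 + z‖ ≤ ‖1 + z‖ / 2 := by nlinarith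
  have e : 1 + w = (1 + z) + (w - z) := by ring
  have hlow : ‖1 + z‖ / 2 ≤ ‖1 + w‖ := by
    have h1 : ‖1 + z‖ ≤ ‖1 + w‖ + ‖w - z‖ := by
      have := norm_sub_le (1 + w) (w - z)
      rwa [show 1 + w - (w - z) = 1 + z by ring] at this
    linarith
  have hup : ‖1 + w‖ ≤ 2 * ‖1 + z‖ := by
    rw [e]
    exact (norm_add_le _ _).trans (by linarith)
  have hne : 1 + w ≠ 0 := norm_pos_iff.mp (by linarith)
  have hre : -(1 + w).re ≤ Real.cos θ / 2 * ‖1 + z‖ := by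
    have h1 := (abs_le.mp (Complex.abs_re_le_norm (w - z))).1
    have h2 := re_one_add_pos hz
    rw [e, Complex.add_re]
    linarith
  have hre' : -(1 + w).re ≤ Real.cos θ * ‖1 + w‖ := by nlinarith
  refine ⟨mem_deltaRegion_of_re hθ hθ' hne ?_ hre', ?_, hlow, hup⟩
  · have h1 : ‖w‖ ≤ ‖z‖ + ‖w - z‖ := by
      have := norm_add_le z (w - z)
      rwa [add_sub_cancel] at this
    have := mem_ball_zero_iff.mp hz
    linarith
  · rw [Complex.mem_slitPlane_iff]
    by_contra! h
    have h1 : ‖1 + w‖ = -(1 + w).re := by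
      rw [← Complex.abs_re_eq_norm.mpr h.2, abs_of_nonpos h.1]
    have := norm_pos_iff.mpr hne
    nlinarith

theorem isLowerOrder_of_delta {A α : ℝ} (hα : 0 < α) {f : ℂ → ℂ} {η θ : ℝ} (hη : 0 < η)
    (hθ : 0 < θ) (hθ' : θ < Real.pi / 2)
    (hf : AnalyticOnNhd ℂ f (deltaRegion (-1) η θ \ {-1}))
    (hequiv : f ~[𝓝[deltaRegion (-1) η θ \ {-1}] (-1)]
      fun z : ℂ => (A : ℂ) * (z + 1) ^ (-(α : ℂ))) :
    IsLowerOrder α fun z => f z - A * (1 + z) ^ (-(α : ℂ)) := by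
  have hball : ∀ z ∈ ball (0 : ℂ) 1, z ∈ deltaRegion (-1) η θ \ {-1} := fun z hz =>
    closedBall_subset_deltaRegion hη hθ hθ' (ball_subset_closedBall hz)
      (norm_pos_iff.mp (norm_one_add_pos hz))
  have hdiff : ∀ z : ℂ, z ∈ deltaRegion (-1) η θ \ {-1} → 1 + z ∈ Complex.slitPlane →
      DifferentiableAt ℂ (fun z => f z - A * (1 + z) ^ (-(α : ℂ))) z := fun z hz hs =>
    (hf z hz).differentiableAt.sub ((hasDerivAt_one_add_cpow α hs).differentiableAt.const_mul _)
  have hnear : ∀ ε : ℝ, 0 < ε → ∃ δ : ℝ, 0 < δ ∧ ∀ z ∈ deltaRegion (-1) η θ \ {-1},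
      ‖1 + z‖ < δ → ‖f z - A * (1 + z) ^ (-(α : ℂ))‖ ≤ ε * (|A| * ‖1 + z‖ ^ (-α)) := by
    intro ε hε
    have h := hequiv.isLittleO.bound hε
    rw [eventually_nhdsWithin_iff, Metric.eventually_nhds_iff] at h
    obtain ⟨δ, hδ, h⟩ := h
    refine ⟨δ, hδ, fun z hz hzδ => ?_⟩
    have := h (y := z) (by rwa [dist_eq_norm, sub_neg_eq_add, add_comm]) hz
    simp only [Pi.sub_apply] at this
    rwa [norm_mul, norm_cpow_neg_ofReal, Complex.norm_real, Real.norm_eq_abs, add_comm z 1] at this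
  have hfar : ∀ δ : ℝ, 0 < δ → ∃ C : ℝ, 0 ≤ C ∧ ∀ z ∈ ball (0 : ℂ) 1, δ ≤ ‖1 + z‖ →
      ‖f z‖ ≤ C ∧ ‖deriv f z‖ ≤ C := by
    intro δ hδ
    have hK : IsCompact (closedBall (0 : ℂ) 1 ∩ {z | δ ≤ ‖1 + z‖}) :=
      (isCompact_closedBall 0 1).inter_right
        (isClosed_le continuous_const (continuous_const.add continuous_id).norm)
    have hsub : closedBall (0 : ℂ) 1 ∩ {z | δ ≤ ‖1 + z‖} ⊆ deltaRegion (-1) η θ \ {-1} :=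
      fun z hz => closedBall_subset_deltaRegion hη hθ hθ' hz.1
        (norm_pos_iff.mp (hδ.trans_le hz.2))
    obtain ⟨C₁, h₁⟩ := hK.exists_bound_of_continuousOn (hf.continuousOn.mono hsub)
    obtain ⟨C₂, h₂⟩ := hK.exists_bound_of_continuousOn (hf.deriv.continuousOn.mono hsub)
    refine ⟨max |C₁| |C₂|, le_max_of_le_left (abs_nonneg _), fun z hz hzδ => ?_⟩
    have hz' : z ∈ closedBall (0 : ℂ) 1 ∩ {z | δ ≤ ‖1 + z‖} := ⟨ball_subset_closedBall hz, hzδ⟩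
    exact ⟨(h₁ z hz').trans ((le_abs_self _).trans (le_max_left _ _)),
      (h₂ z hz').trans ((le_abs_self _).trans (le_max_right _ _))⟩
  have hslit : ∀ z ∈ ball (0 : ℂ) 1, 1 + z ∈ Complex.slitPlane := fun z hz =>
    mem_slitPlane_of_re_pos (re_one_add_pos hz)
  refine ⟨fun z hz => (hdiff z (hball z hz) (hslit z hz)).differentiableWithinAt, ?_,
    fun ε hε => ?_⟩
  · obtain ⟨δ, hδ, hn⟩ := hnear 1 one_pos
    obtain ⟨C, hC0, hC⟩ := hfar δ hδ
    refine ⟨C * 2 ^ α + |A|, fun z hz => ?_⟩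
    have hpos := norm_one_add_pos hz
    rcases lt_or_ge ‖1 + z‖ δ with h | h
    · refine (hn z (hball z hz) h).trans ?_
      rw [one_mul]
      gcongr
      exact le_add_of_nonneg_left (by positivity)
    · refine (norm_sub_le _ _).trans ?_
      rw [norm_mul, norm_cpow_neg_ofReal, Complex.norm_real, Real.norm_eq_abs, add_mul]
      gcongr
      have h2 : (2 : ℝ) ^ (-α) ≤ ‖1 + z‖ ^ (-α) :=
        Real.rpow_le_rpow_of_nonpos hpos (norm_one_add_le_two hz) (by linarith)
      calc ‖f z‖ ≤ C := (hC z hz h).1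
        _ = C * 2 ^ α * 2 ^ (-α) := by
          rw [mul_assoc, ← Real.rpow_add two_pos, add_neg_cancel, Real.rpow_zero, mul_one]
        _ ≤ _ := by gcongr
  · have hκ0 : 0 < Real.cos θ := Real.cos_pos_of_mem_Ioo ⟨by linarith, hθ'⟩
    -- Cancels the losses ahead: `2^α` from comparing `|1 + w|` with `|1 + z|`, and division by the
    -- radius `cos θ / 2 · |1 + z|`. The `+ 1` avoids dividing by `|A|`.
    set ε₁ : ℝ := ε * (Real.cos θ / 2) / ((|A| + 1) * 2 ^ α) with hε₁
    have hε₁0 : 0 < ε₁ := by positivity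
    obtain ⟨δ, hδ, hn⟩ := hnear ε₁ hε₁0
    -- `δ / 3` keeps the whole circle in the region of the asymptotics, as `|1 + w| ≤ 2 |1 + z|`;
    -- `η` keeps it within the radius `1 + η`.
    set δ' : ℝ := min (δ / 3) η with hδ'
    have hδ'0 : 0 < δ' := lt_min (by positivity) hη
    obtain ⟨C, hC0, hC⟩ := hfar δ' hδ'0
    refine ⟨C + |A| * (α * δ' ^ (-α - 1)), fun z hz => ?_⟩
    have hpos := norm_one_add_pos hz
    have hX : 0 ≤ ‖1 + z‖ ^ (-α - 1) := by positivity
    rcases lt_or_ge ‖1 + z‖ δ' with h | h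
    · have hzη : ‖1 + z‖ ≤ η := h.le.trans (min_le_right _ _)
      have hzδ : ‖1 + z‖ < δ / 3 := h.trans_le (min_le_left _ _)
      set ρ : ℝ := Real.cos θ / 2 * ‖1 + z‖ with hρ
      have hρ0 : 0 < ρ := by positivity
      have hdc : DiffContOnCl ℂ (fun z => f z - A * (1 + z) ^ (-(α : ℂ))) (ball z ρ) := by
        refine DifferentiableOn.diffContOnCl_ball (U := closedBall z ρ) (fun w hw => ?_) subset_rfl
        obtain ⟨h1, h2, -, -⟩ := near_of_mem_closedBall hθ hθ' hz hzη hw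
        exact (hdiff w h1 h2).differentiableWithinAt
      have hb : ∀ w ∈ sphere z ρ, ‖f w - A * (1 + w) ^ (-(α : ℂ))‖ ≤
          ε₁ * (|A| * (2 ^ α * ‖1 + z‖ ^ (-α))) := by
        intro w hw
        obtain ⟨h1, -, h3, h4⟩ := near_of_mem_closedBall hθ hθ' hz hzη
          (sphere_subset_closedBall hw)
        refine (hn w h1 (by linarith)).trans ?_
        have h5 : ‖1 + w‖ ^ (-α) ≤ (‖1 + z‖ / 2) ^ (-α) :=
          Real.rpow_le_rpow_of_nonpos (by positivity) h3 (by linarith)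
        have h6 : (‖1 + z‖ / 2) ^ (-α) = 2 ^ α * ‖1 + z‖ ^ (-α) := by
          rw [Real.div_rpow hpos.le two_pos.le, Real.rpow_neg two_pos.le, div_inv_eq_mul, mul_comm]
        rw [← h6]
        gcongr
      refine (Complex.norm_deriv_le_of_forall_mem_sphere_norm_le hρ0 hdc hb).trans ?_
      have h7 : ‖1 + z‖ ^ (-α) = ‖1 + z‖ ^ (-α - 1) * ‖1 + z‖ := by
        rw [Real.rpow_sub_one hpos.ne']; field_simp
      have h8 : ε₁ * (|A| * (2 ^ α * ‖1 + z‖ ^ (-α))) / ρ =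
          |A| / (|A| + 1) * (ε * ‖1 + z‖ ^ (-α - 1)) := by
        rw [h7, hρ, hε₁]
        field_simp
      rw [h8]
      have h9 : |A| / (|A| + 1) ≤ 1 := by
        rw [div_le_one (by positivity)]; linarith
      calc _ ≤ 1 * (ε * ‖1 + z‖ ^ (-α - 1)) := by gcongr
        _ ≤ _ := by
          rw [one_mul]
          exact le_add_of_nonneg_right (by positivity)
    · have hd : HasDerivAt (fun z => f z - A * (1 + z) ^ (-(α : ℂ)))
          (deriv f z - A * (-(α : ℂ) * (1 + z) ^ (-(α : ℂ) - 1))) z :=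
        (hf z (hball z hz)).differentiableAt.hasDerivAt.sub
          ((hasDerivAt_one_add_cpow α (hslit z hz)).const_mul _)
      rw [hd.deriv]
      refine (norm_sub_le _ _).trans ?_
      rw [norm_mul, norm_mul, norm_cpow_neg_ofReal_sub_one, norm_neg, Complex.norm_real,
        Complex.norm_real, Real.norm_eq_abs, Real.norm_eq_abs, abs_of_pos hα]
      have h1 : ‖1 + z‖ ^ (-α - 1) ≤ δ' ^ (-α - 1) :=
        Real.rpow_le_rpow_of_nonpos hδ'0 h (by linarith)
      have h2 : |A| * (α * ‖1 + z‖ ^ (-α - 1)) ≤ |A| * (α * δ' ^ (-α - 1)) := by gcongr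
      have h3 := (hC z hz h).2
      have h4 : 0 ≤ ε * ‖1 + z‖ ^ (-α - 1) := by positivity
      linarith

theorem HasDeltaSingularity.exists_isGenerating {a₀ : ℕ → ℝ} {A α : ℝ} (hα : 0 < α)
    (h : HasDeltaSingularity a₀ A α) :
    ∃ f : ℂ → ℂ, IsGenerating a₀ f ∧ IsLowerOrder α fun z => f z - A * (1 + z) ^ (-(α : ℂ)) := by
  obtain ⟨f, η, θ, hη, hθ, hθ', hsum, hf, hequiv⟩ := h
  refine ⟨f, ⟨fun z hz => ?_, taylorCoeff_eq_of_hasSum hsum⟩,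
    isLowerOrder_of_delta hα hη hθ hθ' hf hequiv⟩
  exact (hf z (closedBall_subset_deltaRegion hη hθ hθ' (ball_subset_closedBall hz)
    (norm_pos_iff.mp (norm_one_add_pos hz)))).differentiableAt.differentiableWithinAt

/-! ### Alternating power laws and the Abelian estimate. -/

/-- `u n ∼ L (-1)^{n+1} n^{α-1}`, also for `L = 0` with `o` in place of `∼`. -/
def HasAlternatingLimit (α : ℝ) (u : ℕ → ℝ) (L : ℝ) : Prop :=
  Tendsto (fun n : ℕ => u n * (-1) ^ (n + 1) / (n : ℝ) ^ (α - 1)) atTop (𝓝 L)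

theorem hasAlternatingLimit_iff_isEquivalent {α L : ℝ} (hL : L ≠ 0) {u : ℕ → ℝ} :
    HasAlternatingLimit α u L ↔
      u ~[atTop] fun n : ℕ => L * (-1) ^ (n + 1) * (n : ℝ) ^ (α - 1) := by
  have hne : ∀ᶠ n : ℕ in atTop, L * (-1) ^ (n + 1) * (n : ℝ) ^ (α - 1) ≠ 0 := by
    filter_upwards [eventually_gt_atTop 0] with n hn
    have : (0 : ℝ) < n := by exact_mod_cast hn
    have h1 : (n : ℝ) ^ (α - 1) ≠ 0 := (Real.rpow_pos_of_pos this _).ne'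
    have h2 : (-1 : ℝ) ^ (n + 1) ≠ 0 := pow_ne_zero _ (by norm_num)
    positivity
  have e : ∀ n : ℕ, u n / (L * (-1) ^ (n + 1) * (n : ℝ) ^ (α - 1)) =
      u n * (-1) ^ (n + 1) / (n : ℝ) ^ (α - 1) / L := by
    intro n
    rcases neg_one_pow_eq_or ℝ (n + 1) with h | h <;> rw [h] <;> ring
  rw [isEquivalent_iff_tendsto_one hne]
  have e' : (u / fun n : ℕ => L * (-1) ^ (n + 1) * (n : ℝ) ^ (α - 1)) =
      fun n : ℕ => u n * (-1) ^ (n + 1) / (n : ℝ) ^ (α - 1) / L := funext e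
  rw [e']
  constructor
  · intro h
    simpa [hL] using h.div_const L
  · intro h
    simpa [hL, div_mul_cancel₀, HasAlternatingLimit] using h.mul_const L

theorem tendsto_succ_rpow_div (s : ℝ) :
    Tendsto (fun n : ℕ => ((n : ℝ)) ^ s / ((n + 1 : ℕ) : ℝ) ^ s) atTop (𝓝 1) := by
  have h1 : Tendsto (fun n : ℕ => (n : ℝ) / ((n : ℝ) + 1)) atTop (𝓝 1) :=
    tendsto_natCast_div_add_atTop 1
  have h2 := h1.rpow_const (p := s) (Or.inl one_ne_zero)
  rw [Real.one_rpow] at h2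
  refine h2.congr fun n => ?_
  rw [Real.div_rpow (by positivity) (by positivity)]
  push_cast
  rfl

theorem hasAlternatingLimit_of_succ {α L : ℝ} {u : ℕ → ℝ}
    (h : Tendsto (fun n : ℕ => u (n + 1) * (-1) ^ n / (n : ℝ) ^ (α - 1)) atTop (𝓝 L)) :
    HasAlternatingLimit α u L := by
  refine (tendsto_add_atTop_iff_nat 1).mp ?_
  have h2 := h.mul (tendsto_succ_rpow_div (α - 1))
  rw [mul_one] at h2
  refine h2.congr' ?_
  filter_upwards [eventually_gt_atTop 0] with n hn
  have h3 : (0 : ℝ) < n := by exact_mod_cast hn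
  have h1 : (n : ℝ) ^ (α - 1) ≠ 0 := (Real.rpow_pos_of_pos h3 _).ne'
  rw [show (-1 : ℝ) ^ (n + 1 + 1) = (-1) ^ n by ring]
  field_simp

theorem hasAlternatingLimit_shellSolution {A α : ℝ} (hα : 0 < α) {f : ℂ → ℂ}
    (hf : IsLowerOrder α fun z => f z - A * (1 + z) ^ (-(α : ℂ))) (t : ℝ) :
    HasAlternatingLimit α (fun n => shellSolution f n t)
      (A * Real.exp ((2 * α - 1) * t) / Real.Gamma α) := by
  refine hasAlternatingLimit_of_succ ?_
  simp_rw [shellSolution_succ]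
  exact (hf.evolve_sub hα t).tendsto_taylorCoeff hα

theorem hasAlternatingPowerLaw_iff {a₀ : ℕ → ℝ} {A α : ℝ} (hA : A ≠ 0) (hα : 0 < α) :
    HasAlternatingPowerLaw a₀ A α ↔ HasAlternatingLimit α a₀ (A / Real.Gamma α) := by
  rw [hasAlternatingLimit_iff_isEquivalent (div_ne_zero hA (Real.Gamma_pos_of_pos hα).ne'),
    HasAlternatingPowerLaw]
  have : (fun n : ℕ => -(A / Real.Gamma α) * (-1) ^ n * (n : ℝ) ^ (α - 1)) =
      fun n : ℕ => A / Real.Gamma α * (-1) ^ (n + 1) * (n : ℝ) ^ (α - 1) := by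
    funext n
    ring
  rw [this]

/-- (D) implies (C), so the first half of the theorem needs only (C). -/
theorem HasDeltaSingularity.hasAlternatingPowerLaw {a₀ : ℕ → ℝ} {A α : ℝ} (hA : A ≠ 0)
    (hα : 0 < α) (h : HasDeltaSingularity a₀ A α) : HasAlternatingPowerLaw a₀ A α := by
  obtain ⟨f, hgen, hf⟩ := h.exists_isGenerating hα
  rw [hasAlternatingPowerLaw_iff hA hα]
  refine hasAlternatingLimit_of_succ ((hf.tendsto_taylorCoeff hα).congr fun n => ?_)
  rw [hgen.taylorCoeff_eq, Complex.ofReal_re]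

theorem hasSum_binomCoeff_real (α : ℝ) {x : ℝ} (h0 : 0 ≤ x) (h1 : x < 1) :
    HasSum (fun n : ℕ => binomCoeff α n * x ^ n) ((1 - x) ^ (-α)) := by
  have h := hasSum_binomCoeff α (z := (x : ℂ)) (by
    rwa [Complex.norm_real, Real.norm_of_nonneg h0])
  have e : (1 - (x : ℂ)) ^ (-(α : ℂ)) = (((1 - x) ^ (-α) : ℝ) : ℂ) := by
    rw [Complex.ofReal_cpow (by linarith)]
    push_cast
    rfl
  rw [e] at h
  exact_mod_cast h

theorem HasAlternatingLimit.tendsto_div_binomCoeff {A α : ℝ} (hα : 0 < α) {u : ℕ → ℝ}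
    (h : HasAlternatingLimit α u (A / Real.Gamma α)) :
    Tendsto (fun n : ℕ => u (n + 1) * (-1) ^ n / binomCoeff α n) atTop (𝓝 A) := by
  have hΓ := (Real.Gamma_pos_of_pos hα).ne'
  have h1 := (tendsto_add_atTop_iff_nat 1).mpr h
  have h2 := (tendsto_succ_rpow_div (α - 1)).inv₀ one_ne_zero
  have h3 := (tendsto_binomCoeff hα).inv₀ (inv_ne_zero hΓ)
  have h4 := (h1.mul h2).mul h3
  rw [inv_one, mul_one, inv_inv, div_mul_cancel₀ _ hΓ] at h4
  refine h4.congr' ?_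
  filter_upwards [eventually_gt_atTop 0] with n hn
  have hn' : (0 : ℝ) < n := by exact_mod_cast hn
  have e1 : (n : ℝ) ^ (α - 1) ≠ 0 := (Real.rpow_pos_of_pos hn' _).ne'
  have e2 : ((n + 1 : ℕ) : ℝ) ^ (α - 1) ≠ 0 := by positivity
  have e3 := (binomCoeff_pos hα n).ne'
  rw [show (-1 : ℝ) ^ (n + 1 + 1) = (-1) ^ n by ring]
  field_simp

/-- The coefficients are dominated by a multiple of `binomCoeff α n`, whose series converges
throughout the unit disk. -/
theorem HasAlternatingLimit.exists_isGenerating {A α : ℝ} (hα : 0 < α) {a₀ : ℕ → ℝ}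
    (h : HasAlternatingLimit α a₀ (A / Real.Gamma α)) : ∃ f : ℂ → ℂ, IsGenerating a₀ f := by
  obtain ⟨K, hK⟩ := (h.tendsto_div_binomCoeff hα).norm.bddAbove_range
  have hb : ∀ n : ℕ, |a₀ (n + 1)| ≤ K * binomCoeff α n := by
    intro n
    have h1 : ‖a₀ (n + 1) * (-1) ^ n / binomCoeff α n‖ ≤ K := hK ⟨n, rfl⟩
    rwa [norm_div, norm_mul, norm_pow, norm_neg, norm_one, one_pow, mul_one, Real.norm_eq_abs,
      Real.norm_of_nonneg (binomCoeff_pos hα n).le, div_le_iff₀ (binomCoeff_pos hα n)] at h1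
  have hterm : ∀ r : ℝ, ∀ z ∈ ball (0 : ℂ) r, ∀ n : ℕ,
      ‖(a₀ (n + 1) : ℂ) * z ^ n‖ ≤ K * (binomCoeff α n * r ^ n) := by
    intro r z hz n
    rw [norm_mul, norm_pow, Complex.norm_real, Real.norm_eq_abs, ← mul_assoc]
    have := (mem_ball_zero_iff.mp hz).le
    exact mul_le_mul (hb n) (pow_le_pow_left₀ (norm_nonneg _) this n) (by positivity)
      ((abs_nonneg _).trans (hb n))
  refine ⟨fun z => ∑' n : ℕ, (a₀ (n + 1) : ℂ) * z ^ n, fun z hz => ?_,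
    taylorCoeff_eq_of_hasSum ?_⟩
  · obtain ⟨r, hzr, hr1⟩ := exists_between (mem_ball_zero_iff.mp hz)
    have hz' : z ∈ ball (0 : ℂ) r := mem_ball_zero_iff.mpr hzr
    have hd := Complex.differentiableOn_tsum_of_summable_norm
      ((hasSum_binomCoeff_real α ((norm_nonneg z).trans hzr.le) hr1).summable.mul_left K)
      (F := fun n z => (a₀ (n + 1) : ℂ) * z ^ n) (U := ball 0 r)
      (fun n => ((differentiable_id.pow n).const_mul _).differentiableOn) isOpen_ball
      (fun n w hw => hterm r w hw n)
    exact (hd.differentiableAt (isOpen_ball.mem_nhds hz')).differentiableWithinAt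
  · filter_upwards [ball_mem_nhds (0 : ℂ) (by norm_num : (0 : ℝ) < 1 / 2)] with z hz
    refine Summable.hasSum (Summable.of_norm_bounded ?_ (hterm (1 / 2) z hz))
    exact (hasSum_binomCoeff_real α (by norm_num) (by norm_num)).summable.mul_left K

theorem IsGenerating.hasSum {a₀ : ℕ → ℝ} {f : ℂ → ℂ} (hf : IsGenerating a₀ f) {z : ℂ}
    (hz : z ∈ ball (0 : ℂ) 1) : HasSum (fun n : ℕ => (a₀ (n + 1) : ℂ) * z ^ n) (f z) := by
  simpa only [hf.taylorCoeff_eq] using hasSum_taylorCoeff hf.differentiableOn hz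

/-- Abelian bound: the deviation of the generating function from `A (1 + z)^{-α}`. -/
theorem IsGenerating.exists_bound_sub {A α : ℝ} (hα : 0 < α) {a₀ : ℕ → ℝ} {f : ℂ → ℂ}
    (hf : IsGenerating a₀ f) (h : HasAlternatingLimit α a₀ (A / Real.Gamma α)) {ε : ℝ}
    (hε : 0 < ε) :
    ∃ C : ℝ, 0 ≤ C ∧ ∀ w ∈ ball (0 : ℂ) 1,
      ‖f w - A * (1 + w) ^ (-(α : ℂ))‖ ≤ ε * (1 - ‖w‖) ^ (-α) + C := by
  set e : ℕ → ℝ := fun n => a₀ (n + 1) - A * (binomCoeff α n * (-1) ^ n) with he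
  have hsmall : ∀ᶠ n in atTop, |e n| ≤ ε * binomCoeff α n := by
    have h1 := (h.tendsto_div_binomCoeff hα).sub_const A
    rw [sub_self] at h1
    filter_upwards [(h1.abs.eventually (gt_mem_nhds (by rwa [abs_zero])))] with n hn
    have hb := binomCoeff_pos hα n
    have hs : |(-1 : ℝ) ^ n| = 1 := by rw [abs_pow, abs_neg, abs_one, one_pow]
    have e1 : e n = (a₀ (n + 1) * (-1) ^ n / binomCoeff α n - A) * binomCoeff α n * (-1) ^ n := by
      have hs' : ((-1 : ℝ) ^ n) * (-1) ^ n = 1 := by rw [← mul_pow]; simp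
      rw [he, sub_mul, div_mul_cancel₀ _ hb.ne']
      linear_combination (-a₀ (n + 1)) * hs'
    rw [e1, abs_mul, hs, mul_one, abs_mul, abs_of_pos hb]
    gcongr
  obtain ⟨N, hN⟩ := eventually_atTop.mp hsmall
  -- The finitely many early coefficients go into the constant; the tail is `ε` times the binomial
  -- series at `‖w‖`.
  refine ⟨∑ n ∈ Finset.range N, |e n|, Finset.sum_nonneg fun _ _ => abs_nonneg _, fun w hw => ?_⟩
  have hw1 := mem_ball_zero_iff.mp hw
  have hsum : HasSum (fun n : ℕ => (e n : ℂ) * w ^ n) (f w - A * (1 + w) ^ (-(α : ℂ))) := by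
    have h2 := (hasSum_binomCoeff α (z := -w) (by rwa [norm_neg])).mul_left (A : ℂ)
    rw [sub_neg_eq_add] at h2
    refine ((hf.hasSum hw).sub h2).congr_fun fun n => ?_
    rw [he, neg_pow w]
    push_cast
    ring
  have hg : HasSum (fun n : ℕ => ε * (binomCoeff α n * ‖w‖ ^ n) +
      if n ∈ Finset.range N then |e n| else 0)
      (ε * (1 - ‖w‖) ^ (-α) + ∑ n ∈ Finset.range N, |e n|) := by
    refine ((hasSum_binomCoeff_real α (norm_nonneg w) hw1).mul_left ε).add ?_
    have : HasSum (fun n => if n ∈ Finset.range N then |e n| else 0)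
        (∑ n ∈ Finset.range N, if n ∈ Finset.range N then |e n| else 0) :=
      hasSum_sum_of_ne_finset_zero fun n hn => if_neg hn
    rwa [Finset.sum_congr rfl fun n hn => if_pos hn] at this
  rw [← hsum.tsum_eq]
  refine tsum_of_norm_bounded hg fun n => ?_
  rw [norm_mul, norm_pow, Complex.norm_real, Real.norm_eq_abs]
  have hp : 0 ≤ binomCoeff α n * ‖w‖ ^ n :=
    mul_nonneg (binomCoeff_pos hα n).le (by positivity)
  split_ifs with hn
  · have : |e n| * ‖w‖ ^ n ≤ |e n| * 1 := by
      gcongr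
      exact pow_le_one₀ (norm_nonneg _) hw1.le
    have := mul_nonneg hε.le hp
    linarith
  · rw [add_zero, ← mul_assoc]
    gcongr
    exact hN n (by simpa using hn)

/-! ### Long-time limit of each mode. -/

/-- The limit shape of the rescaled generating function. -/
noncomputable def limitShape (α : ℝ) (z : ℂ) : ℂ :=
  ((1 - z) / 2) ^ ((α : ℂ) - 1) * (1 + z) ^ (-(α : ℂ))

theorem re_one_sub_div_two_pos {z : ℂ} (hz : z ∈ ball (0 : ℂ) 1) : 0 < ((1 - z) / 2).re := by
  have h := re_one_add_pos (z := -z) (by simpa using hz)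
  rw [show (1 - z) / 2 = ((1 / 2 : ℝ) : ℂ) * (1 + -z) by push_cast; ring, Complex.re_ofReal_mul]
  linarith

theorem differentiableOn_limitShape (α : ℝ) : DifferentiableOn ℂ (limitShape α) (ball 0 1) := by
  intro z hz
  have h1 : DifferentiableAt ℂ (fun z : ℂ => ((1 - z) / 2) ^ ((α : ℂ) - 1)) z :=
    ((((hasDerivAt_id' z).const_sub 1).div_const 2).cpow_const (c := (α : ℂ) - 1)
      (mem_slitPlane_of_re_pos (re_one_sub_div_two_pos hz))).differentiableAt
  exact (h1.mul (hasDerivAt_one_add_cpow α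
    (mem_slitPlane_of_re_pos (re_one_add_pos hz))).differentiableAt).differentiableWithinAt

/-- The factor is a normalization: `limitShape` uses `(1 - z)/2`, the limit of `e^{-t} flowDen t z`,
in place of `1 - z`. -/
theorem taylorC_eq (α : ℝ) (n : ℕ) :
    taylorC α n = 2 ^ (α - 1) * (taylorCoeff (limitShape α) n).re := by
  refine iteratedDeriv_div_factorial_of_hasSum
    (c := fun n => 2 ^ (α - 1) * (taylorCoeff (limitShape α) n).re) ?_ n
  filter_upwards [ball_mem_nhds (0 : ℝ) one_pos] with x hx
  have hx' := abs_lt.mp (mem_ball_zero_iff.mp hx)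
  have hxc : (x : ℂ) ∈ ball (0 : ℂ) 1 := by
    rw [mem_ball_zero_iff, Complex.norm_real]
    exact mem_ball_zero_iff.mp hx
  have h1 : 0 < 1 - x := by linarith [hx'.2]
  have h2 : 0 < 1 + x := by linarith [hx'.1]
  have h := (Complex.hasSum_re (hasSum_taylorCoeff (differentiableOn_limitShape α) hxc)).mul_left
    ((2 : ℝ) ^ (α - 1))
  have e1 : ∀ n : ℕ, (taylorCoeff (limitShape α) n * (x : ℂ) ^ n).re =
      (taylorCoeff (limitShape α) n).re * x ^ n := by
    intro n
    rw [← Complex.ofReal_pow, Complex.re_mul_ofReal]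
  have e2 : limitShape α x = (((1 - x) / 2) ^ (α - 1) * (1 + x) ^ (-α) : ℝ) := by
    rw [limitShape]
    push_cast [Complex.ofReal_cpow (by positivity : 0 ≤ (1 - x) / 2),
      Complex.ofReal_cpow h2.le]
    rfl
  simp_rw [e1, ← mul_assoc] at h
  have e3 : 1 / (1 - x) * ((1 - x) / (1 + x)) ^ α = 2 ^ (α - 1) * (limitShape α x).re := by
    rw [e2, Complex.ofReal_re, Real.div_rpow h1.le two_pos.le, Real.div_rpow h1.le h2.le,
      Real.rpow_neg h2.le, Real.rpow_sub_one h1.ne']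
    field_simp
  rw [e3]
  exact h

theorem exp_neg_mul_flowDen (t : ℝ) (z : ℂ) :
    (Real.exp (-t) : ℂ) * flowDen t z =
      (1 - z) / 2 + (Real.exp (-(2 * t)) : ℂ) * ((1 + z) / 2) := by
  have h : Real.exp (-(2 * t)) = Real.exp (-t) * Real.exp (-t) := by
    rw [← Real.exp_add]; congr 1; ring
  have h1 : (Real.exp t : ℂ) * Real.exp (-t) = 1 := by
    rw [← Complex.ofReal_mul, ← Real.exp_add, add_neg_cancel, Real.exp_zero, Complex.ofReal_one]
  rw [flowDen, Real.cosh_eq, Real.sinh_eq, h]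
  push_cast at h1 ⊢
  linear_combination ((1 - z) / 2) * h1

theorem tendsto_exp_neg_mul_flowDen (z : ℂ) :
    Tendsto (fun t : ℝ => (Real.exp (-t) : ℂ) * flowDen t z) atTop (𝓝 ((1 - z) / 2)) := by
  simp_rw [exp_neg_mul_flowDen]
  have h : Tendsto (fun t : ℝ => Real.exp (-(2 * t))) atTop (𝓝 0) :=
    Real.tendsto_exp_neg_atTop_nhds_zero.comp (tendsto_id.const_mul_atTop two_pos)
  have h2 : Tendsto (fun t : ℝ => (Real.exp (-(2 * t)) : ℂ)) atTop (𝓝 0) := by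
    exact_mod_cast (Complex.continuous_ofReal.tendsto 0).comp h
  simpa using (h2.mul_const ((1 + z) / 2)).const_add ((1 - z) / 2)

theorem norm_exp_neg_mul_flowDen {t : ℝ} (ht : 0 ≤ t) {z : ℂ} (hz : z ∈ sphere (0 : ℂ) (1 / 2)) :
    1 / 4 ≤ ‖(Real.exp (-t) : ℂ) * flowDen t z‖ ∧ ‖(Real.exp (-t) : ℂ) * flowDen t z‖ ≤ 1 := by
  have hz1 : ‖z‖ = 1 / 2 := mem_sphere_zero_iff_norm.mp hz
  set q : ℝ := Real.exp (-(2 * t)) with hq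
  have hq0 : 0 < q := Real.exp_pos _
  have hq1 : q ≤ 1 := Real.exp_le_one_iff.mpr (by linarith)
  have e : (Real.exp (-t) : ℂ) * flowDen t z =
      (((1 + q) / 2 : ℝ) : ℂ) - (((1 - q) / 2 : ℝ) : ℂ) * z := by
    rw [exp_neg_mul_flowDen, ← hq]
    push_cast
    ring
  have n1 : ‖(((1 + q) / 2 : ℝ) : ℂ)‖ = (1 + q) / 2 := by
    rw [Complex.norm_real, Real.norm_of_nonneg (by positivity)]
  have n2 : ‖(((1 - q) / 2 : ℝ) : ℂ) * z‖ = (1 - q) / 4 := by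
    rw [norm_mul, Complex.norm_real, Real.norm_of_nonneg (by linarith), hz1]
    ring
  rw [e]
  constructor
  · have := norm_sub_norm_le (((1 + q) / 2 : ℝ) : ℂ) ((((1 - q) / 2 : ℝ) : ℂ) * z)
    rw [n1, n2] at this
    linarith
  · have := norm_sub_le (((1 + q) / 2 : ℝ) : ℂ) ((((1 - q) / 2 : ℝ) : ℂ) * z)
    rw [n1, n2] at this
    linarith

theorem norm_flowDen_eq (t : ℝ) (z : ℂ) :
    ‖flowDen t z‖ = Real.exp t * ‖(Real.exp (-t) : ℂ) * flowDen t z‖ := by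
  rw [norm_mul, Complex.norm_real, Real.norm_of_nonneg (Real.exp_pos _).le, ← mul_assoc,
    ← Real.exp_add, add_neg_cancel, Real.exp_zero, one_mul]

/-- The circle approaches `-1` non-tangentially. From `1 - |w|² = (3/4) / |flowDen|²` with
`|flowDen| ≤ e^t` comes `1 - |w| ≥ (3/8) e^{-2t}`, so the radial Abelian bound loses nothing in
order. -/
theorem one_sub_norm_flow_rpow_le {α : ℝ} (hα : 0 < α) {t : ℝ} (ht : 0 ≤ t) {z : ℂ}
    (hz : z ∈ sphere (0 : ℂ) (1 / 2)) :
    (1 - ‖flow t z‖) ^ (-α) ≤ (3 / 8) ^ (-α) * Real.exp (2 * α * t) := by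
  have hz1 : ‖z‖ = 1 / 2 := mem_sphere_zero_iff_norm.mp hz
  have hz2 : ‖z‖ < 1 := by rw [hz1]; norm_num
  have h1 := one_sub_norm_flow_sq t hz2.le
  have h2 := norm_flow_lt_one t hz2
  have h3 := (norm_exp_neg_mul_flowDen ht hz).2
  have hd0 : 0 < ‖flowDen t z‖ := norm_pos_iff.mpr (flowDen_ne_zero t hz2.le)
  have hd : ‖flowDen t z‖ ≤ Real.exp t := by
    rw [norm_flowDen_eq]
    exact mul_le_of_le_one_right (Real.exp_pos _).le h3
  have h4 : 3 / 8 * Real.exp (-(2 * t)) ≤ 1 - ‖flow t z‖ := by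
    have h5 : (3 / 4 : ℝ) * Real.exp (-(2 * t)) ≤ (1 - ‖z‖ ^ 2) / ‖flowDen t z‖ ^ 2 := by
      rw [hz1, le_div_iff₀ (by positivity)]
      have : ‖flowDen t z‖ ^ 2 ≤ Real.exp (2 * t) := by
        rw [two_mul, Real.exp_add, ← sq]
        gcongr
      calc 3 / 4 * Real.exp (-(2 * t)) * ‖flowDen t z‖ ^ 2
          ≤ 3 / 4 * Real.exp (-(2 * t)) * Real.exp (2 * t) := by gcongr
        _ = 3 / 4 := by rw [mul_assoc, ← Real.exp_add, neg_add_cancel, Real.exp_zero, mul_one]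
        _ ≤ _ := by norm_num
    nlinarith [norm_nonneg (flow t z)]
  refine (Real.rpow_le_rpow_of_nonpos (by positivity) h4 (by linarith)).trans (le_of_eq ?_)
  rw [Real.mul_rpow (by norm_num) (Real.exp_pos _).le, ← Real.exp_mul]
  congr 2
  ring

/-- The generating function, rescaled, near the limit shape. -/
theorem rescaled_evolve_eq (α A t : ℝ) (f : ℂ → ℂ) {z : ℂ} (hz : z ∈ ball (0 : ℂ) 1) :
    (Real.exp (-((2 * α - 1) * t)) : ℂ) * evolve f t z =
      A * (((Real.exp (-t) : ℂ) * flowDen t z) ^ ((α : ℂ) - 1) * (1 + z) ^ (-(α : ℂ))) +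
      (Real.exp (-((2 * α - 1) * t)) : ℂ) *
        ((f (flow t z) - A * (1 + flow t z) ^ (-(α : ℂ))) / flowDen t z) := by
  have hz1 := (mem_ball_zero_iff.mp hz).le
  have hne := flowDen_ne_zero t hz1
  have hpos : (Real.exp (-t) : ℂ) ≠ 0 := by exact_mod_cast (Real.exp_pos _).ne'
  have e1 : ((Real.exp (-t) : ℂ) * flowDen t z) ^ ((α : ℂ) - 1) =
      (Real.exp ((1 - α) * t) : ℂ) * flowDen t z ^ ((α : ℂ) - 1) := by
    rw [Complex.cpow_def_of_ne_zero (mul_ne_zero hpos hne), Complex.cpow_def_of_ne_zero hne,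
      Complex.log_ofReal_mul (Real.exp_pos _) hne, Real.log_exp, Complex.ofReal_exp,
      ← Complex.exp_add]
    congr 1
    push_cast
    ring
  have e2 : Real.exp ((1 - α) * t) = Real.exp (-((2 * α - 1) * t)) * Real.exp (α * t) := by
    rw [← Real.exp_add]; congr 1; ring
  rw [e1, e2, one_add_flow_cpow α t hz, ← flowDen_cpow_div α t hne, evolve]
  push_cast
  field_simp
  ring

/-- The growth `e^{2αt}` of the Abelian bound cancels exactly against the rescaling and the
denominator. The `ε` term stays uniformly small and the constant term decays. -/
theorem norm_rescaled_remainder_le {α : ℝ} (hα : 0 < α) {h : ℂ → ℂ} {ε C : ℝ} (hε : 0 ≤ ε)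
    (hC : 0 ≤ C) (hh : ∀ w ∈ ball (0 : ℂ) 1, ‖h w‖ ≤ ε * (1 - ‖w‖) ^ (-α) + C) {t : ℝ}
    (ht : 0 ≤ t) {z : ℂ} (hz : z ∈ sphere (0 : ℂ) (1 / 2)) :
    ‖(Real.exp (-((2 * α - 1) * t)) : ℂ) * (h (flow t z) / flowDen t z)‖ ≤
      4 * (ε * (3 / 8) ^ (-α) + C * Real.exp (-(2 * α * t))) := by
  have hz1 : ‖z‖ = 1 / 2 := mem_sphere_zero_iff_norm.mp hz
  have hz2 : z ∈ ball (0 : ℂ) 1 := by rw [mem_ball_zero_iff, hz1]; norm_num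
  have hd : Real.exp t / 4 ≤ ‖flowDen t z‖ := by
    rw [norm_flowDen_eq]
    have := (norm_exp_neg_mul_flowDen ht hz).1
    have := mul_le_mul_of_nonneg_left this (Real.exp_pos t).le
    linarith
  have hb : ‖h (flow t z)‖ ≤ ε * ((3 / 8) ^ (-α) * Real.exp (2 * α * t)) + C := by
    refine (hh _ (flow_mem_ball t hz2)).trans ?_
    gcongr
    exact one_sub_norm_flow_rpow_le hα ht hz
  rw [norm_mul, norm_div, Complex.norm_real, Real.norm_of_nonneg (Real.exp_pos _).le]
  have e1 : Real.exp (-((2 * α - 1) * t)) = Real.exp (-(2 * α * t)) * Real.exp t := by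
    rw [← Real.exp_add]; congr 1; ring
  have e2 : Real.exp (-(2 * α * t)) * Real.exp (2 * α * t) = 1 := by
    rw [← Real.exp_add, neg_add_cancel, Real.exp_zero]
  have hexp := Real.exp_pos t
  calc Real.exp (-((2 * α - 1) * t)) * (‖h (flow t z)‖ / ‖flowDen t z‖)
      ≤ Real.exp (-((2 * α - 1) * t)) *
        ((ε * ((3 / 8) ^ (-α) * Real.exp (2 * α * t)) + C) / (Real.exp t / 4)) := by gcongr
    _ = 4 * (Real.exp (-(2 * α * t)) * (ε * ((3 / 8) ^ (-α) * Real.exp (2 * α * t)) + C)) := by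
        rw [e1]; field_simp
    _ = _ := by linear_combination 4 * ε * (3 / 8) ^ (-α) * e2

theorem tendsto_exp_neg_mul_atTop {c : ℝ} (hc : 0 < c) :
    Tendsto (fun t : ℝ => Real.exp (-(c * t))) atTop (𝓝 0) :=
  Real.tendsto_exp_neg_atTop_nhds_zero.comp (tendsto_id.const_mul_atTop hc)

theorem IsGenerating.tendsto_shellSolution {A α : ℝ} (hα : 0 < α) {a₀ : ℕ → ℝ} {f : ℂ → ℂ}
    (hf : IsGenerating a₀ f) (h : HasAlternatingLimit α a₀ (A / Real.Gamma α)) (m : ℕ) :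
    Tendsto (fun t : ℝ => shellSolution f (m + 1) t / Real.exp ((2 * α - 1) * t)) atTop
      (𝓝 ((2 : ℝ) ^ (1 - α) * A * taylorC α m)) := by
  set r : ℂ → ℂ := fun w => f w - A * (1 + w) ^ (-(α : ℂ)) with hr
  have hsub : sphere (0 : ℂ) (1 / 2) ⊆ ball 0 1 :=
    sphere_subset_closedBall.trans (closedBall_subset_ball (by norm_num))
  have hrem : ∀ z ∈ sphere (0 : ℂ) (1 / 2), Tendsto (fun t : ℝ =>
      (Real.exp (-((2 * α - 1) * t)) : ℂ) * (r (flow t z) / flowDen t z)) atTop (𝓝 0) := by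
    intro z hz
    rw [tendsto_zero_iff_norm_tendsto_zero, Metric.tendsto_nhds]
    intro δ hδ
    have hp : (0 : ℝ) < (3 / 8) ^ (-α) := by positivity
    -- Chosen so that the `ε` part of the remainder is exactly `δ / 2`.
    obtain ⟨C, hC0, hC⟩ := hf.exists_bound_sub hα h (ε := δ / (8 * (3 / 8) ^ (-α)))
      (by positivity)
    have hlim : Tendsto (fun t : ℝ => 4 * (C * Real.exp (-(2 * α * t)))) atTop (𝓝 0) := by
      simpa using ((tendsto_exp_neg_mul_atTop (by positivity : 0 < 2 * α)).const_mul C).const_mul 4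
    filter_upwards [hlim.eventually (gt_mem_nhds (half_pos hδ)), eventually_ge_atTop 0]
      with t ht ht0
    rw [dist_zero_right, norm_norm]
    refine (norm_rescaled_remainder_le hα (by positivity) hC0 hC ht0 hz).trans_lt ?_
    have : 4 * (δ / (8 * (3 / 8) ^ (-α)) * (3 / 8 : ℝ) ^ (-α)) = δ / 2 := by
      field_simp; norm_num
    linarith
  have hlimz : ∀ z ∈ sphere (0 : ℂ) (1 / 2), Tendsto (fun t : ℝ =>
      (Real.exp (-((2 * α - 1) * t)) : ℂ) * evolve f t z) atTop (𝓝 (A * limitShape α z)) := by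
    intro z hz
    have h1 : Tendsto (fun t : ℝ => ((Real.exp (-t) : ℂ) * flowDen t z) ^ ((α : ℂ) - 1)) atTop
        (𝓝 (((1 - z) / 2) ^ ((α : ℂ) - 1))) :=
      (continuousAt_cpow_const (b := (α : ℂ) - 1) (mem_slitPlane_of_re_pos
        (re_one_sub_div_two_pos (hsub hz)))).tendsto.comp (tendsto_exp_neg_mul_flowDen z)
    have h2 := ((h1.mul_const ((1 + z) ^ (-(α : ℂ)))).const_mul (A : ℂ)).add (hrem z hz)
    rw [add_zero] at h2
    exact h2.congr fun t => (rescaled_evolve_eq α A t f (hsub hz)).symm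
  obtain ⟨C, hC0, hC⟩ := hf.exists_bound_sub hα h one_pos
  have hbound : ∀ᶠ t : ℝ in atTop, ∀ z ∈ sphere (0 : ℂ) (1 / 2),
      ‖(Real.exp (-((2 * α - 1) * t)) : ℂ) * evolve f t z‖ ≤
        |A| * ((1 + (1 / 4) ^ (α - 1)) * (1 / 2) ^ (-α)) + 4 * (1 * (3 / 8) ^ (-α) + C * 1) := by
    filter_upwards [eventually_ge_atTop 0] with t ht z hz
    rw [rescaled_evolve_eq α A t f (hsub hz)]
    refine (norm_add_le _ _).trans (add_le_add ?_
      ((norm_rescaled_remainder_le hα zero_le_one hC0 hC ht hz).trans ?_))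
    · obtain ⟨h1, h2⟩ := norm_exp_neg_mul_flowDen ht hz
      have e : ((α : ℂ) - 1) = ((α - 1 : ℝ) : ℂ) := by push_cast; rfl
      rw [norm_mul, norm_mul, norm_cpow_neg_ofReal, Complex.norm_real, Real.norm_eq_abs, e,
        Complex.norm_cpow_real]
      -- The base lies in `[1/4, 1]`; the sum covers both signs of `α - 1`.
      have h3 : ‖(Real.exp (-t) : ℂ) * flowDen t z‖ ^ (α - 1) ≤ 1 + (1 / 4) ^ (α - 1) := by
        have hp : (0 : ℝ) < (1 / 4) ^ (α - 1) := by positivity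
        rcases le_or_gt 0 (α - 1) with hs | hs
        · have := Real.rpow_le_one (norm_nonneg _) h2 hs
          linarith
        · have := Real.rpow_le_rpow_of_nonpos (by norm_num) h1 hs.le
          linarith
      have h4 : (1 / 2 : ℝ) ≤ ‖1 + z‖ := by
        have h5 := norm_sub_norm_le (1 : ℂ) (-z)
        rw [norm_neg, norm_one, mem_sphere_zero_iff_norm.mp hz, sub_neg_eq_add] at h5
        linarith
      have h6 : ‖1 + z‖ ^ (-α) ≤ (1 / 2) ^ (-α) :=
        Real.rpow_le_rpow_of_nonpos (by norm_num) h4 (by linarith)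
      gcongr
    · have : Real.exp (-(2 * α * t)) ≤ 1 := Real.exp_le_one_iff.mpr (by
        have : 0 ≤ 2 * α * t := by positivity
        linarith)
      gcongr
  have hev := differentiableOn_evolve hf.differentiableOn
  have key := tendsto_taylorCoeff (l := atTop)
    (F := fun t z => (Real.exp (-((2 * α - 1) * t)) : ℂ) * evolve f t z)
    (f := fun z => A * limitShape α z) (r := 1) (R := 1 / 2) (by norm_num) (by norm_num)
    (fun t => (hev t).const_mul _) ((differentiableOn_limitShape α).const_mul _) hbound hlimz m
  have key2 := (Complex.continuous_re.tendsto _).comp key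
  have e1 : (taylorCoeff (fun z => A * limitShape α z) m).re =
      2 ^ (1 - α) * A * taylorC α m := by
    rw [taylorCoeff_const_mul one_pos (differentiableOn_limitShape α), Complex.re_ofReal_mul,
      taylorC_eq]
    have : (2 : ℝ) ^ (1 - α) * 2 ^ (α - 1) = 1 := by
      rw [← Real.rpow_add two_pos]; simp
    linear_combination (-(A * (taylorCoeff (limitShape α) m).re)) * this
  rw [e1] at key2
  refine key2.congr fun t => ?_
  rw [Function.comp_apply, taylorCoeff_const_mul one_pos (hev t), Complex.re_ofReal_mul,
    shellSolution_succ, Real.exp_neg]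
  field_simp

/-! ### Energy balance and conservation for finite initial energy. -/

/-- The interactions inside the block cancel in pairs, leaving only the flux from mode `N` to mode
`N + 1`. -/
theorem IsSolution.hasDerivWithinAt_blockEnergy {a₀ : ℕ → ℝ} {a : ℕ → ℝ → ℝ}
    (ha : IsSolution a₀ a) (N : ℕ) {t : ℝ} (ht : 0 ≤ t) :
    HasDerivWithinAt (blockEnergy a 0 N) (-(2 * N * (a N t * a (N + 1) t))) (Set.Ici 0) t := by
  induction N with
  | zero =>
    refine ((hasDerivWithinAt_const t (Set.Ici 0) (0 : ℝ)).congr (fun s hs => ?_) ?_).congr_deriv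
      (by simp)
    · simp [blockEnergy, ha.boundary s hs]
    · simp [blockEnergy, ha.boundary t ht]
  | succ N ih =>
    have e : blockEnergy a 0 (N + 1) = fun s => blockEnergy a 0 N s + a (N + 1) s ^ 2 := by
      funext s
      rw [blockEnergy, Finset.sum_Icc_succ_top (Nat.zero_le _), sq_abs]
      rfl
    rw [e]
    refine (ih.add ((ha.ode N t ht).fun_pow 2)).congr_deriv ?_
    push_cast
    ring

theorem tendsto_blockEnergy {a : ℕ → ℝ → ℝ} {t : ℝ} (h : FiniteEnergy a t) :
    Tendsto (fun N => blockEnergy a 0 N t) atTop (𝓝 (∑' n : ℕ, |a n t| ^ 2)) := by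
  have h1 := (h.hasSum.tendsto_sum_nat).comp (tendsto_add_atTop_nat 1)
  refine h1.congr fun N => ?_
  rw [Function.comp_apply, blockEnergy, Nat.range_succ_eq_Icc_zero]

/-- Energy is conserved by exponentially decaying solutions. -/
theorem IsSolution.energy_eq_of_decay {a₀ : ℕ → ℝ} {a : ℕ → ℝ → ℝ} (ha : IsSolution a₀ a)
    {T K q : ℝ} (hT : 0 ≤ T) (hK : 0 ≤ K) (hq0 : 0 ≤ q) (hq : q < 1)
    (hb : ∀ t ∈ Set.Icc 0 T, ∀ n : ℕ, |a n t| ≤ K * q ^ n) :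
    FiniteEnergy a T ∧ ∑' n : ℕ, |a n T| ^ 2 = ∑' n : ℕ, |a n 0| ^ 2 := by
  have hq2 : q ^ 2 < 1 := by nlinarith
  have hfin : ∀ t ∈ Set.Icc 0 T, FiniteEnergy a t := by
    intro t ht
    refine Summable.of_nonneg_of_le (fun n => by positivity) (fun n => ?_)
      ((summable_geometric_of_lt_one (by positivity) hq2).mul_left (K ^ 2))
    calc |a n t| ^ 2 ≤ (K * q ^ n) ^ 2 := by gcongr; exact hb t ht n
      _ = _ := by rw [mul_pow, ← pow_mul, ← pow_mul, mul_comm n 2]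
  have h0 : (0 : ℝ) ∈ Set.Icc 0 T := ⟨le_rfl, hT⟩
  have hT' : T ∈ Set.Icc 0 T := ⟨hT, le_rfl⟩
  refine ⟨hfin T hT', ?_⟩
  have hdiff := (tendsto_blockEnergy (hfin T hT')).sub (tendsto_blockEnergy (hfin 0 h0))
  -- The flux through mode `N` is `O(N q^{2N})` uniformly on `[0, T]`, and integrating it in time
  -- bounds the change of the block energy.
  have hbound : ∀ N : ℕ, ‖blockEnergy a 0 N T - blockEnergy a 0 N 0‖ ≤
      2 * K ^ 2 * q * T * (N * (q ^ 2) ^ N) := by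
    intro N
    have hd : ∀ t ∈ Set.Icc 0 T, HasDerivWithinAt (blockEnergy a 0 N)
        (-(2 * N * (a N t * a (N + 1) t))) (Set.Icc 0 T) t := fun t ht =>
      (ha.hasDerivWithinAt_blockEnergy N ht.1).mono Set.Icc_subset_Ici_self
    have hle : ∀ t ∈ Set.Icc 0 T, ‖-(2 * N * (a N t * a (N + 1) t))‖ ≤
        2 * N * (K * q ^ N * (K * q ^ (N + 1))) := by
      intro t ht
      rw [norm_neg, norm_mul, norm_mul, norm_mul, Real.norm_eq_abs (a N t),
        Real.norm_eq_abs (a (N + 1) t), Real.norm_ofNat, Real.norm_natCast]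
      gcongr
      · exact hb t ht N
      · exact hb t ht (N + 1)
    have := (convex_Icc 0 T).norm_image_sub_le_of_norm_hasDerivWithin_le hd hle h0 hT'
    refine this.trans (le_of_eq ?_)
    rw [sub_zero, Real.norm_of_nonneg hT]
    ring
  have hlim : Tendsto (fun N : ℕ => 2 * K ^ 2 * q * T * (N * (q ^ 2) ^ N)) atTop (𝓝 0) := by
    simpa using (tendsto_self_mul_const_pow_of_lt_one (by positivity) hq2).const_mul
      (2 * K ^ 2 * q * T)
  exact sub_eq_zero.mp (tendsto_nhds_unique hdiff (squeeze_zero_norm hbound hlim))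

/-- Truncated initial data. -/
def truncData (a₀ : ℕ → ℝ) (M n : ℕ) : ℝ := if n ≤ M then a₀ n else 0

/-- The generating polynomial of truncated initial data. -/
noncomputable def truncGen (a₀ : ℕ → ℝ) (M : ℕ) (z : ℂ) : ℂ :=
  ∑ n ∈ Finset.range M, (a₀ (n + 1) : ℂ) * z ^ n

theorem differentiable_truncGen (a₀ : ℕ → ℝ) (M : ℕ) : Differentiable ℂ (truncGen a₀ M) := by
  unfold truncGen
  fun_prop

theorem isGenerating_truncGen (a₀ : ℕ → ℝ) (M : ℕ) :
    IsGenerating (truncData a₀ M) (truncGen a₀ M) := by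
  refine ⟨(differentiable_truncGen a₀ M).differentiableOn,
    taylorCoeff_eq_of_hasSum (Eventually.of_forall fun z => ?_)⟩
  have h : HasSum (fun n : ℕ => (truncData a₀ M (n + 1) : ℂ) * z ^ n)
      (∑ n ∈ Finset.range M, (truncData a₀ M (n + 1) : ℂ) * z ^ n) := by
    refine hasSum_sum_of_ne_finset_zero fun n hn => ?_
    rw [truncData, if_neg (by simpa using hn)]
    simp
  have e : ∑ n ∈ Finset.range M, (truncData a₀ M (n + 1) : ℂ) * z ^ n = truncGen a₀ M z := by
    refine Finset.sum_congr rfl fun n hn => ?_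
    rw [truncData, if_pos (Nat.succ_le_of_lt (Finset.mem_range.mp hn))]
  rwa [e] at h

/-- For polynomial data the only possible singularity at time `t > 0` is the pole `coth t > 1` of `1
/ flowDen`. Up to time `T` the solution is thus holomorphic in one disk larger than the unit disk,
and the modes decay exponentially. -/
theorem energy_truncGen (a₀ : ℕ → ℝ) (M : ℕ) {T : ℝ} (hT : 0 ≤ T) :
    FiniteEnergy (shellSolution (truncGen a₀ M)) T ∧
      ∑' n : ℕ, |shellSolution (truncGen a₀ M) n T| ^ 2 =
        ∑' n : ℕ, |shellSolution (truncGen a₀ M) n 0| ^ 2 := by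
  -- `1 + e^{-2T}` lies below `coth T`, hence below every pole up to time `T`.
  set δ : ℝ := Real.exp (-(2 * T)) with hδ
  have hδ0 : 0 < δ := Real.exp_pos _
  have hden : ∀ t ∈ Set.Icc 0 T, ∀ z ∈ ball (0 : ℂ) (1 + δ), flowDen t z ≠ 0 := by
    intro t ht z hz
    refine flowDen_ne_zero_of_lt ?_
    have hs : 0 ≤ Real.sinh t := Real.sinh_nonneg_iff.mpr ht.1
    rw [abs_of_nonneg hs]
    have h1 : ‖z‖ * Real.sinh t ≤ (1 + δ) * Real.sinh t := by
      gcongr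
      exact (mem_ball_zero_iff.mp hz).le
    have h2 : δ ≤ Real.exp (-t) * Real.exp (-t) := by
      rw [← Real.exp_add, hδ]
      exact Real.exp_le_exp.mpr (by linarith [ht.2])
    have h3 : Real.sinh t ≤ Real.exp t / 2 := by
      rw [Real.sinh_eq]
      linarith [Real.exp_pos (-t)]
    have h4 : δ * Real.sinh t ≤ Real.exp (-t) / 2 := by
      calc δ * Real.sinh t ≤ Real.exp (-t) * Real.exp (-t) * (Real.exp t / 2) := by gcongr
        _ = Real.exp (-t) * (Real.exp (-t) * Real.exp t) / 2 := by ring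
        _ = _ := by rw [← Real.exp_add, neg_add_cancel, Real.exp_zero, mul_one]
    have h5 := Real.cosh_sub_sinh t
    linarith [Real.exp_pos (-t)]
  have hsub : closedBall (0 : ℂ) (1 + δ / 2) ⊆ ball 0 (1 + δ) :=
    closedBall_subset_ball (by linarith)
  have hflow : ContinuousOn (fun p : ℝ × ℂ => flow p.1 p.2)
      (Set.Icc 0 T ×ˢ closedBall 0 (1 + δ / 2)) :=
    ContinuousOn.div (Continuous.continuousOn (by fun_prop)) (continuousOn_flowDen _)
      fun p hp => hden p.1 hp.1 p.2 (hsub hp.2)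
  have hcont : ContinuousOn (fun p : ℝ × ℂ => evolve (truncGen a₀ M) p.1 p.2)
      (Set.Icc 0 T ×ˢ closedBall 0 (1 + δ / 2)) :=
    ((differentiable_truncGen a₀ M).continuous.comp_continuousOn hflow).div
      (continuousOn_flowDen _) fun p hp => hden p.1 hp.1 p.2 (hsub hp.2)
  obtain ⟨K, hK0, hK⟩ := exists_bound_taylorCoeff_evolve (by positivity) hcont
    (by linarith : 1 + δ / 2 < 1 + δ) fun t ht z hz =>
      (hasDerivAt_evolve_space (hden t ht z hz)
        (differentiable_truncGen a₀ M _)).differentiableAt.differentiableWithinAt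
  exact (isSolution_shellSolution (isGenerating_truncGen a₀ M)).energy_eq_of_decay hT hK0
    (by positivity) (inv_lt_one_of_one_lt₀ (by linarith)) hK

theorem IsGenerating.tendsto_truncGen {a₀ : ℕ → ℝ} {f : ℂ → ℂ} (hf : IsGenerating a₀ f)
    (n : ℕ) (t : ℝ) :
    Tendsto (fun M => shellSolution (truncGen a₀ M) n t) atTop (𝓝 (shellSolution f n t)) := by
  rcases n with _ | n
  · simp only [shellSolution_zero]
    exact tendsto_const_nhds
  simp only [shellSolution_succ]
  refine (Complex.continuous_re.tendsto _).comp ?_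
  have hsub : sphere (0 : ℂ) (1 / 2) ⊆ ball 0 1 :=
    sphere_subset_closedBall.trans (closedBall_subset_ball (by norm_num))
  -- At the point of the circle whose image is farthest out, the series converges absolutely; its
  -- sum dominates all partial sums on the whole circle.
  obtain ⟨z₀, hz₀, hmax⟩ := (isCompact_sphere (0 : ℂ) (1 / 2)).exists_isMaxOn
    (NormedSpace.sphere_nonempty.mpr (by norm_num))
    (f := fun z => ‖flow t z‖) (ContinuousOn.norm fun z hz =>
      (hasDerivAt_flow_space (flowDen_ne_zero t
        (mem_ball_zero_iff.mp (hsub hz)).le)).continuousAt.continuousWithinAt)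
  obtain ⟨B, hB0, hB⟩ := exists_bound_of_differentiableOn_nhds (isOpen_flowDomain t)
    (closedBall_subset_flowDomain t) (differentiableOn_inv_flowDen t)
  have hsum := (hf.hasSum (flow_mem_ball t (hsub hz₀))).summable.norm
  refine tendsto_taylorCoeff (r := 1) (R := 1 / 2)
    (C := (∑' n, ‖(a₀ (n + 1) : ℂ) * flow t z₀ ^ n‖) * B) (by norm_num) (by norm_num)
    (fun M => differentiableOn_evolve (differentiable_truncGen a₀ M).differentiableOn t)
    (differentiableOn_evolve hf.differentiableOn t) (Eventually.of_forall fun M z hz => ?_)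
    (fun z hz => ?_) n
  · rw [evolve, div_eq_mul_inv, norm_mul]
    refine mul_le_mul ?_ (hB z (hsub hz)).1 (norm_nonneg _) (tsum_nonneg fun _ => norm_nonneg _)
    refine (norm_sum_le _ _).trans (le_trans (Finset.sum_le_sum fun n _ => ?_)
      (hsum.sum_le_tsum (Finset.range M) fun _ _ => norm_nonneg _))
    rw [norm_mul, norm_mul, norm_pow, norm_pow]
    gcongr
    exact hmax hz
  · exact ((hf.hasSum (flow_mem_ball t (hsub hz))).tendsto_sum_nat).div_const _

theorem IsGenerating.shellSolution_at_zero {a₀ : ℕ → ℝ} {f : ℂ → ℂ} (hf : IsGenerating a₀ f)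
    (n : ℕ) : shellSolution f n 0 = if n = 0 then 0 else a₀ n := by
  rcases n with _ | n
  · simp [shellSolution_zero]
  · rw [shellSolution_succ, evolve_zero, hf.taylorCoeff_eq, Complex.ofReal_re,
      if_neg n.succ_ne_zero]

theorem IsGenerating.truncGen_at_zero {a₀ : ℕ → ℝ} {f : ℂ → ℂ} (hf : IsGenerating a₀ f)
    (M n : ℕ) : shellSolution (truncGen a₀ M) n 0 =
      if n ∈ Finset.range (M + 1) then shellSolution f n 0 else 0 := by
  rw [(isGenerating_truncGen a₀ M).shellSolution_at_zero, hf.shellSolution_at_zero, truncData]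
  simp only [Finset.mem_range, Nat.lt_succ_iff]
  split_ifs <;> rfl

theorem IsGenerating.energy_truncGen_zero {a₀ : ℕ → ℝ} {f : ℂ → ℂ} (hf : IsGenerating a₀ f)
    (M : ℕ) : ∑' n : ℕ, |shellSolution (truncGen a₀ M) n 0| ^ 2 =
      ∑ n ∈ Finset.range (M + 1), |shellSolution f n 0| ^ 2 := by
  rw [tsum_eq_sum (s := Finset.range (M + 1)) fun n hn => by
    rw [hf.truncGen_at_zero, if_neg hn]; simp]
  exact Finset.sum_congr rfl fun n hn => by rw [hf.truncGen_at_zero, if_pos hn]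

/-- The energy does not increase. -/
theorem IsGenerating.energy_le {a₀ : ℕ → ℝ} {f : ℂ → ℂ} (hf : IsGenerating a₀ f)
    (h0 : FiniteEnergy (shellSolution f) 0) {t : ℝ} (ht : 0 ≤ t) :
    FiniteEnergy (shellSolution f) t ∧
      ∑' n : ℕ, |shellSolution f n t| ^ 2 ≤ ∑' n : ℕ, |shellSolution f n 0| ^ 2 := by
  -- Fatou's argument: each finite set of modes passes to the limit in `M`, and each truncation
  -- conserves an energy bounded by the full initial one.
  have hs : ∀ s : Finset ℕ, ∑ n ∈ s, |shellSolution f n t| ^ 2 ≤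
      ∑' n : ℕ, |shellSolution f n 0| ^ 2 := by
    intro s
    have hlim : Tendsto (fun M => ∑ n ∈ s, |shellSolution (truncGen a₀ M) n t| ^ 2) atTop
        (𝓝 (∑ n ∈ s, |shellSolution f n t| ^ 2)) :=
      tendsto_finsetSum _ fun n _ => ((hf.tendsto_truncGen n t).abs).pow 2
    refine le_of_tendsto' hlim fun M => ?_
    obtain ⟨h1, h2⟩ := energy_truncGen a₀ M ht
    refine (h1.sum_le_tsum s fun _ _ => by positivity).trans ?_
    rw [h2, hf.energy_truncGen_zero]
    exact h0.sum_le_tsum _ fun _ _ => by positivity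
  have hfin : FiniteEnergy (shellSolution f) t :=
    summable_of_sum_le (fun _ => by positivity) hs
  exact ⟨hfin, hfin.tsum_le_of_sum_le hs⟩

theorem shellSolution_sub {f g : ℂ → ℂ} (hf : DifferentiableOn ℂ f (ball 0 1))
    (hg : DifferentiableOn ℂ g (ball 0 1)) (n : ℕ) (t : ℝ) :
    shellSolution (fun z => f z - g z) n t = shellSolution f n t - shellSolution g n t := by
  rcases n with _ | n
  · simp [shellSolution_zero]
  · have e : evolve (fun z => f z - g z) t = fun z => evolve f t z - evolve g t z := by
      funext z
      simp only [evolve, sub_div]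
    rw [shellSolution_succ, shellSolution_succ, shellSolution_succ, e,
      taylorCoeff_sub one_pos (differentiableOn_evolve hf t) (differentiableOn_evolve hg t),
      Complex.sub_re]

theorem sq_le_weighted {x y ε : ℝ} (hε : 0 < ε) :
    |x| ^ 2 ≤ (1 + ε) * |y| ^ 2 + (1 + 1 / ε) * |y - x| ^ 2 := by
  rw [sq_abs, sq_abs, sq_abs]
  have h : (1 + ε) * y ^ 2 + (1 + 1 / ε) * (y - x) ^ 2 - x ^ 2 =
      (ε * y + (y - x)) ^ 2 / ε := by
    field_simp
    ring
  have : 0 ≤ (ε * y + (y - x)) ^ 2 / ε := by positivity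
  linarith

/-- Solutions of finite initial energy conserve it. -/
theorem IsGenerating.energy_eq {a₀ : ℕ → ℝ} {f : ℂ → ℂ} (hf : IsGenerating a₀ f)
    (h0 : FiniteEnergy (shellSolution f) 0) {t : ℝ} (ht : 0 ≤ t) :
    FiniteEnergy (shellSolution f) t ∧
      ∑' n : ℕ, |shellSolution f n t| ^ 2 = ∑' n : ℕ, |shellSolution f n 0| ^ 2 := by
  obtain ⟨hfin, hle⟩ := hf.energy_le h0 ht
  refine ⟨hfin, hle.antisymm ?_⟩
  set E₀ : ℝ := ∑' n : ℕ, |shellSolution f n 0| ^ 2 with hE₀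
  set E : ℝ := ∑' n : ℕ, |shellSolution f n t| ^ 2 with hE
  have hpart : Tendsto (fun M => ∑ n ∈ Finset.range (M + 1), |shellSolution f n 0| ^ 2) atTop
      (𝓝 E₀) := h0.hasSum.tendsto_sum_nat.comp (tendsto_add_atTop_nat 1)
  -- The truncated solution conserves its energy, and the discarded part has energy at most its
  -- initial tail by `IsGenerating.energy_le`. Comparing the two through `sq_le_weighted` and
  -- letting `M → ∞` leaves the factor `1 + ε`.
  have key : ∀ ε : ℝ, 0 < ε → E₀ ≤ (1 + ε) * E := by
    intro ε hε
    have hlim : Tendsto (fun M => (1 + ε) * E + (1 + 1 / ε) *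
        (E₀ - ∑ n ∈ Finset.range (M + 1), |shellSolution f n 0| ^ 2)) atTop
        (𝓝 ((1 + ε) * E)) := by
      simpa using ((hpart.const_sub E₀).const_mul (1 + 1 / ε)).const_add ((1 + ε) * E)
    refine le_of_tendsto_of_tendsto' hpart hlim fun M => ?_
    have hg : IsGenerating (fun n => a₀ n - truncData a₀ M n)
        (fun z => f z - truncGen a₀ M z) := by
      refine ⟨hf.differentiableOn.sub (isGenerating_truncGen a₀ M).differentiableOn, fun n => ?_⟩
      rw [taylorCoeff_sub one_pos hf.differentiableOn
        (isGenerating_truncGen a₀ M).differentiableOn, hf.taylorCoeff_eq,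
        (isGenerating_truncGen a₀ M).taylorCoeff_eq, Complex.ofReal_sub]
    have hsub := fun n s => shellSolution_sub hf.differentiableOn
      (isGenerating_truncGen a₀ M).differentiableOn n s
    have hzero : ∀ n, |shellSolution (fun z => f z - truncGen a₀ M z) n 0| ^ 2 =
        |shellSolution f n 0| ^ 2 -
          if n ∈ Finset.range (M + 1) then |shellSolution f n 0| ^ 2 else 0 := by
      intro n
      rw [hsub, hf.truncGen_at_zero]
      split_ifs <;> simp
    have hfinsum : HasSum (fun n => if n ∈ Finset.range (M + 1) then |shellSolution f n 0| ^ 2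
        else 0) (∑ n ∈ Finset.range (M + 1), |shellSolution f n 0| ^ 2) := by
      have : HasSum (fun n => if n ∈ Finset.range (M + 1) then |shellSolution f n 0| ^ 2 else 0)
          (∑ n ∈ Finset.range (M + 1), if n ∈ Finset.range (M + 1) then |shellSolution f n 0| ^ 2
            else 0) := hasSum_sum_of_ne_finset_zero fun n hn => if_neg hn
      rwa [Finset.sum_congr rfl fun n hn => if_pos hn] at this
    have htail : HasSum (fun n => |shellSolution (fun z => f z - truncGen a₀ M z) n 0| ^ 2)
        (E₀ - ∑ n ∈ Finset.range (M + 1), |shellSolution f n 0| ^ 2) := by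
      simp_rw [hzero]
      exact h0.hasSum.sub hfinsum
    obtain ⟨hdfin, hdle⟩ := hg.energy_le htail.summable ht
    rw [htail.tsum_eq] at hdle
    obtain ⟨hpfin, hpeq⟩ := energy_truncGen a₀ M ht
    rw [← hf.energy_truncGen_zero, ← hpeq]
    calc ∑' n : ℕ, |shellSolution (truncGen a₀ M) n t| ^ 2
        ≤ ∑' n : ℕ, ((1 + ε) * |shellSolution f n t| ^ 2 +
          (1 + 1 / ε) * |shellSolution (fun z => f z - truncGen a₀ M z) n t| ^ 2) := by
          refine hpfin.tsum_le_tsum (fun n => ?_)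
            ((hfin.mul_left _).add (hdfin.mul_left _))
          rw [hsub]
          exact sq_le_weighted hε
      _ = (1 + ε) * E + (1 + 1 / ε) *
          ∑' n : ℕ, |shellSolution (fun z => f z - truncGen a₀ M z) n t| ^ 2 := by
          rw [(hfin.mul_left _).tsum_add (hdfin.mul_left _), tsum_mul_left, tsum_mul_left]
      _ ≤ _ := by gcongr; rwa [hpeq, hf.energy_truncGen_zero]
  have hlim : Tendsto (fun ε : ℝ => (1 + ε) * E) (𝓝[>] 0) (𝓝 ((1 + 0) * E)) :=
    ((tendsto_id.mono_left nhdsWithin_le_nhds).const_add 1).mul_const E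
  rw [add_zero, one_mul] at hlim
  exact ge_of_tendsto hlim (eventually_nhdsWithin_of_forall fun ε hε => key ε hε)

/-! ### Energy rates from the power law. -/

theorem HasAlternatingLimit.congr' {α L : ℝ} {u v : ℕ → ℝ} (h : HasAlternatingLimit α u L)
    (huv : u =ᶠ[atTop] v) : HasAlternatingLimit α v L := by
  refine Tendsto.congr' ?_ h
  filter_upwards [huv] with n hn
  rw [hn]

theorem HasAlternatingLimit.summable_sq_iff {α L : ℝ} (hL : L ≠ 0) {u : ℕ → ℝ}
    (h : HasAlternatingLimit α u L) : (Summable fun n : ℕ => |u n| ^ 2) ↔ α < 1 / 2 := by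
  have h1 := ((hasAlternatingLimit_iff_isEquivalent hL).mp h).pow 2
  have e1 : (fun n : ℕ => |u n| ^ 2) = u ^ 2 := by
    funext n
    simp
  have e2 : (fun n : ℕ => L * (-1) ^ (n + 1) * (n : ℝ) ^ (α - 1)) ^ 2 =
      fun n : ℕ => L ^ 2 * (n : ℝ) ^ ((α - 1) * 2) := by
    funext n
    rw [Pi.pow_apply, mul_pow, mul_pow, ← pow_mul, mul_comm (n + 1), pow_mul, neg_one_sq,
      one_pow, mul_one, Real.rpow_mul (Nat.cast_nonneg n), ← Real.rpow_natCast (_ ^ _) 2]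
    norm_num
  rw [e1, h1.summable_iff_nat, e2, summable_mul_left_iff (pow_ne_zero 2 hL),
    Real.summable_nat_rpow]
  constructor <;> intro h <;> linarith

/-- Consecutive modes have opposite signs, so the limiting flux coefficient is positive; the factor
`N` raises `N^{2α-2}` to `N^{2α-1}`. -/
theorem HasAlternatingLimit.tendsto_rate {α L : ℝ} {u : ℕ → ℝ} (h : HasAlternatingLimit α u L) :
    Tendsto (fun N : ℕ => -(2 * N * (u N * u (N + 1))) / (N : ℝ) ^ (2 * α - 1)) atTop
      (𝓝 (2 * L ^ 2)) := by
  have h1 := ((tendsto_add_atTop_iff_nat 1).mpr h).mul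
    ((tendsto_succ_rpow_div (α - 1)).inv₀ one_ne_zero)
  have h2 := ((Tendsto.mul h h1).const_mul 2)
  rw [inv_one, mul_one, ← sq] at h2
  refine h2.congr' ?_
  filter_upwards [eventually_gt_atTop 0] with n hn
  have hn' : (0 : ℝ) < n := by exact_mod_cast hn
  have e1 : (n : ℝ) ^ (α - 1) ≠ 0 := (Real.rpow_pos_of_pos hn' _).ne'
  have e2 : ((n + 1 : ℕ) : ℝ) ^ (α - 1) ≠ 0 := by positivity
  have e3 : (n : ℝ) ^ (2 * α - 1) = n * ((n : ℝ) ^ (α - 1) * (n : ℝ) ^ (α - 1)) := by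
    rw [← Real.rpow_add hn', mul_comm (n : ℝ), ← Real.rpow_add_one hn'.ne']
    congr 1
    ring
  rw [e3]
  have hs : (-1 : ℝ) ^ (n + 1) * (-1) ^ (n + 1 + 1) = -1 := by
    rw [pow_succ _ (n + 1), ← mul_assoc, ← mul_pow]
    simp
  field_simp
  linear_combination (u n * u (n + 1)) * hs

theorem tendsto_natCast_rpow_zero {s : ℝ} (hs : s < 0) :
    Tendsto (fun N : ℕ => (N : ℝ) ^ s) atTop (𝓝 0) := by
  have h := (tendsto_rpow_neg_atTop (neg_pos.mpr hs)).comp tendsto_natCast_atTop_atTop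
  rwa [neg_neg] at h

theorem rpow_ne_zero_eventually (s : ℝ) : ∀ᶠ N : ℕ in atTop, (N : ℝ) ^ s ≠ 0 := by
  filter_upwards [eventually_gt_atTop 0] with n hn
  exact (Real.rpow_pos_of_pos (by exact_mod_cast hn) _).ne'

section EnergyRate

variable {a₀ : ℕ → ℝ} {a : ℕ → ℝ → ℝ} {α L t : ℝ}

theorem IsSolution.energyRate_of_lt (ha : IsSolution a₀ a) (ht : 0 ≤ t)
    (h : HasAlternatingLimit α (fun n => a n t) L) (hα : α < 1 / 2) :
    EnergyRateTendsto a t (𝓝 0) := by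
  refine ⟨_, fun N => ha.hasDerivWithinAt_blockEnergy N ht, ?_⟩
  have h1 := h.tendsto_rate.mul (tendsto_natCast_rpow_zero (s := 2 * α - 1) (by linarith))
  rw [mul_zero] at h1
  refine h1.congr' ?_
  filter_upwards [rpow_ne_zero_eventually (2 * α - 1)] with N hN
  rw [div_mul_cancel₀ _ hN]

theorem IsSolution.energyRate_of_eq (ha : IsSolution a₀ a) (ht : 0 ≤ t)
    (h : HasAlternatingLimit α (fun n => a n t) L) (hα : α = 1 / 2) :
    EnergyRateTendsto a t (𝓝 (2 * L ^ 2)) := by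
  refine ⟨_, fun N => ha.hasDerivWithinAt_blockEnergy N ht, ?_⟩
  refine h.tendsto_rate.congr fun N => ?_
  rw [hα]
  norm_num

theorem IsSolution.energyRate_of_gt (ha : IsSolution a₀ a) (ht : 0 ≤ t) (hL : L ≠ 0)
    (h : HasAlternatingLimit α (fun n => a n t) L) (hα : 1 / 2 < α) :
    EnergyRateTendsto a t atTop := by
  refine ⟨_, fun N => ha.hasDerivWithinAt_blockEnergy N ht, ?_⟩
  have h0 : Tendsto (fun N : ℕ => (N : ℝ) ^ (2 * α - 1)) atTop atTop :=
    (tendsto_rpow_atTop (by linarith)).comp tendsto_natCast_atTop_atTop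
  have h1 := h.tendsto_rate.pos_mul_atTop (by positivity : 0 < 2 * L ^ 2) h0
  refine h1.congr' ?_
  filter_upwards [rpow_ne_zero_eventually (2 * α - 1)] with N hN
  rw [div_mul_cancel₀ _ hN]

end EnergyRate

/-! ### Assembly of the theorem. -/

/-- Every solution is the explicit one. -/
theorem IsGenerating.eq_shellSolution {a₀ : ℕ → ℝ} {f : ℂ → ℂ} (hf : IsGenerating a₀ f)
    {a : ℕ → ℝ → ℝ} (ha : IsSolution a₀ a) (n : ℕ) {t : ℝ} (ht : 0 ≤ t) :
    a n t = shellSolution f n t :=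
  ha.unique (isSolution_shellSolution hf) n ht

/-- For `α < 1/2` the power law makes the initial energy finite, so the finite-energy alternative
always applies. -/
theorem IsGenerating.isConservative {a₀ : ℕ → ℝ} {f : ℂ → ℂ} (hf : IsGenerating a₀ f)
    {α L : ℝ} (hL : L ≠ 0) (h : HasAlternatingLimit α a₀ L) (hα : α < 1 / 2) {a : ℕ → ℝ → ℝ}
    (ha : IsSolution a₀ a) : IsConservative a := by
  have heq : ∀ t : ℝ, 0 ≤ t → (fun n => |a n t| ^ 2) = fun n => |shellSolution f n t| ^ 2 :=
    fun t ht => funext fun n => by rw [hf.eq_shellSolution ha n ht]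
  have h0 : FiniteEnergy (shellSolution f) 0 := by
    refine (HasAlternatingLimit.summable_sq_iff (α := α) hL (h.congr' ?_)).mpr hα
    filter_upwards [eventually_gt_atTop 0] with n hn
    rw [hf.shellSolution_at_zero, if_neg hn.ne']
  refine Or.inl fun t ht => ?_
  rw [FiniteEnergy, heq t ht, heq 0 le_rfl]
  exact hf.energy_eq h0 ht

end ShellModel

theorem mainTheorem5 (a₀ : ℕ → ℝ) (A α : ℝ) (hA : A ≠ 0) (hα : 0 < α) :
    (ShellModel.HasAlternatingPowerLaw a₀ A α ∨ ShellModel.HasDeltaSingularity a₀ A α →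
      (∃ a : ℕ → ℝ → ℝ, ShellModel.IsSolution a₀ a) ∧
      ∀ a : ℕ → ℝ → ℝ, ShellModel.IsSolution a₀ a →
        (∀ m : ℕ,
          Tendsto (fun t : ℝ => a (m + 1) t / Real.exp ((2 * α - 1) * t)) atTop
            (𝓝 ((2 : ℝ) ^ (1 - α) * A * ShellModel.taylorC α m)) ∧
          (ShellModel.taylorC α m ≠ 0 →
            (fun t : ℝ => a (m + 1) t) ~[atTop] fun t : ℝ =>
              (2 : ℝ) ^ (1 - α) * Real.exp ((2 * α - 1) * t) * A * ShellModel.taylorC α m)) ∧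
        (α < 1 / 2 → ShellModel.IsConservative a)) ∧
    (ShellModel.HasDeltaSingularity a₀ A α →
      ∀ a : ℕ → ℝ → ℝ, ShellModel.IsSolution a₀ a →
        (∀ t : ℝ, 0 ≤ t →
          (fun n : ℕ => a n t) ~[atTop] fun n : ℕ =>
            A / Real.Gamma α * Real.exp ((2 * α - 1) * t) * (-1) ^ (n + 1) *
              (n : ℝ) ^ (α - 1)) ∧
        (α < 1 / 2 → ∀ t : ℝ, 0 ≤ t → ShellModel.EnergyRateTendsto a t (𝓝 0)) ∧
        (α = 1 / 2 → ShellModel.HasFiniteExplosionRate a) ∧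
        (1 / 2 < α → ShellModel.HasInfiniteExplosionRate a)) := by
  have hΓ := (Real.Gamma_pos_of_pos hα).ne'
  refine ⟨fun hCD => ?_, fun hD a ha => ?_⟩
  -- Both alternatives are reduced to the power law (C).
  · have hC : ShellModel.HasAlternatingLimit α a₀ (A / Real.Gamma α) :=
      (ShellModel.hasAlternatingPowerLaw_iff hA hα).mp
        (hCD.elim id fun hD => hD.hasAlternatingPowerLaw hA hα)
    obtain ⟨f, hf⟩ := hC.exists_isGenerating hα
    refine ⟨⟨_, ShellModel.isSolution_shellSolution hf⟩, fun a ha => ⟨fun m => ?_,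
      fun hα' => hf.isConservative (div_ne_zero hA hΓ) hC hα' ha⟩⟩
    have hlim : Tendsto (fun t : ℝ => a (m + 1) t / Real.exp ((2 * α - 1) * t)) atTop
        (𝓝 ((2 : ℝ) ^ (1 - α) * A * ShellModel.taylorC α m)) := by
      refine (hf.tendsto_shellSolution hα hC m).congr' ?_
      filter_upwards [eventually_ge_atTop 0] with t ht
      rw [hf.eq_shellSolution ha _ ht]
    refine ⟨hlim, fun hne => ?_⟩
    -- A nonzero limit is what turns convergence of the quotient into asymptotic equivalence.
    have hc : (2 : ℝ) ^ (1 - α) * A * ShellModel.taylorC α m ≠ 0 := by positivity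
    have h1 := ((isEquivalent_const_iff_tendsto hc).mpr hlim).mul
      (IsEquivalent.refl (u := fun t : ℝ => Real.exp ((2 * α - 1) * t)) (l := atTop))
    have e1 : (fun t : ℝ => a (m + 1) t) = (fun t : ℝ => a (m + 1) t /
        Real.exp ((2 * α - 1) * t)) * fun t : ℝ => Real.exp ((2 * α - 1) * t) := by
      funext t
      rw [Pi.mul_apply, div_mul_cancel₀ _ (Real.exp_pos _).ne']
    have e2 : (fun t : ℝ => (2 : ℝ) ^ (1 - α) * Real.exp ((2 * α - 1) * t) * A *
        ShellModel.taylorC α m) = (Function.const ℝ ((2 : ℝ) ^ (1 - α) * A *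
        ShellModel.taylorC α m)) * fun t : ℝ => Real.exp ((2 * α - 1) * t) := by
      funext t
      rw [Pi.mul_apply, Function.const_apply]
      ring
    rw [e1, e2]
    exact h1
  · obtain ⟨f, hgen, hf⟩ := hD.exists_isGenerating hα
    have hL : ∀ t : ℝ, A * Real.exp ((2 * α - 1) * t) / Real.Gamma α ≠ 0 := fun t =>
      div_ne_zero (mul_ne_zero hA (Real.exp_pos _).ne') hΓ
    have hlim : ∀ t : ℝ, 0 ≤ t → ShellModel.HasAlternatingLimit α (fun n => a n t)
        (A * Real.exp ((2 * α - 1) * t) / Real.Gamma α) := fun t ht =>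
      (ShellModel.hasAlternatingLimit_shellSolution hα hf t).congr'
        (Eventually.of_forall fun n => (hgen.eq_shellSolution ha n ht).symm)
    refine ⟨fun t ht => ?_, fun hα' t ht => ha.energyRate_of_lt ht (hlim t ht) hα',
      fun hα' t ht => ⟨fun hfin => ?_, _, ?_, ha.energyRate_of_eq ht (hlim t ht) hα'⟩,
      fun hα' t ht => ⟨fun hfin => ?_, ha.energyRate_of_gt ht (hL t) (hlim t ht) hα'⟩⟩
    · refine ((ShellModel.hasAlternatingLimit_iff_isEquivalent (hL t)).mp
        (hlim t ht)).congr_right (Eventually.of_forall fun n => ?_)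
      ring
    · exact absurd (((hlim t ht).summable_sq_iff (hL t)).mp hfin) (by linarith)
    · have := hL t
      positivity
    · exact absurd (((hlim t ht).summable_sq_iff (hL t)).mp hfin) (by linarith)
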